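/- Let $\mathbb X$ be a finite set with a pseudometric $d$, and let $\psi(X),\bar\psi(X)$ ($X\in\mathbb X$) be the generators of a complex Grassmann algebra. For $C:\mathbb X\times\mathbb X\to\mathbb C$ let $\langle\cdot\rangle=\int d\mu_C(\psi)\,(\cdot)$ be the Gaussian expectation with covariance $C$, that is, the linear functional on this algebra with $\langle e^{(\bar\eta,\psi)+(\bar\psi,\eta)}\rangle=e^{(\bar\eta,C\eta)}$ for Grassmann sources $\eta,\bar\eta$; here $(\bar\eta,\psi)=\sum_X\bar\eta(X)\psi(X)$ and $(\bar\eta,C\eta)=\sum_{X,Y}\bar\eta(X)C(X,Y)\eta(Y)$. For even elements $V_1,\dots,V_p$ of the algebra without constant term, let $$\langle V_1;\dots;V_p\rangle_c=\frac{\partial^p}{\partial\lambda_1\cdots\partial\lambda_p}\log\Big\langle e^{\lambda_1V_1+\dots+\lambda_pV_p}\Big\rangle\Big|_{\lambda_1=\dots=\lambda_p=0}$$ be their connected correlation (at $\psi=\bar\psi=0$). **Theorem 4.** Assume that there are a complex Hilbert space $\mathcal H$, vectors $f_X,g_X\in\mathcal H$ and a constant $\gamma_C>0$ with $C(X,Y)=\langle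 f_X,g_Y\rangle$ and $\|f_X\|\le\gamma_C$, $\|g_X\|\le\gamma_C$ for all $X,Y\in\mathbb X$, and that there are constants $\tilde\omega_C$ and $\ell_C>0$ such that for all $X,X'\in\mathbb X$ $$\max\{|C(X,X')|,|C(X',X)|\}\le\gamma_C^2\,\tilde\omega_C\,e^{-d(X,X')/\ell_C}.$$ Let $p\ge2$, let $m_q,\bar m_q\ge0$ be integers such that $m_q+\bar m_q>0$ is even for $q=1,\dots,p$, let $m=\sum_qm_q$, $\bar m=\sum_q\bar m_q$, and let $X_{q,i}\in\mathbb X$ ($1\le i\le m_q$) and $Y_{q,j}\in\mathbb X$ ($1\le j\le\bar m_q$). Let $\mathcal G=\langle V_1;\dots;V_p\rangle_c$ be the connected correlation of the monomials $V_q=\bar\psi(Y_{q,1})\cdots\bar\psi(Y_{q,\bar m_q})\,\psi(X_{q,1})\cdots\psi(X_{q,m_q})$. Then $$|\mathcal G|\le(p-2)!\;\tilde\omega_C^{\,p-1}\,(3\gamma_C)^{\bar m+m}\,e^{-\mathcal L/\ell_C} \qquad\text{and}\qquad |\mathcal G|\le(p-2)!\;(2\tilde\omega_C)^{p-1}\,(2\gamma_C)^{\bar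 m+m}\,e^{-\mathcal L/\ell_C}.$$ Here $\mathcal L$ is the minimal length of a tree connecting the external points: the minimum, over all trees $T$ with vertex set $\{1,\dots,p\}$ and over all choices, for every edge $\{a,b\}$ of $T$, of an order $(q,q')=(a,b)$ or $(q,q')=(b,a)$ and of indices $1\le i\le m_q$, $1\le j\le\bar m_{q'}$, of the sum over the edges of $T$ of $d(X_{q,i},Y_{q',j})$. If no tree admits such a choice, then $\mathcal L=\infty$ and $e^{-\mathcal L/\ell_C}=0$. -/

import Mathlib

open scoped ENNReal

noncomputable section

namespace FermionicCumulant

/-! ### Finite-dimensional Grassmann algebras -/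

/-- The complex Grassmann algebra with anticommuting generators indexed by `α`. -/
abbrev Grassmann (α : Type*) : Type _ := ExteriorAlgebra ℂ (α →₀ ℂ)

/-- The generator with index `a`. -/
def gen {α : Type*} (a : α) : Grassmann α :=
  ExteriorAlgebra.ι ℂ (Finsupp.single a 1)

/-! ### The Gaussian expectation

The generators indexed by `𝕏 ⊕ 𝕏` are used twice: for the fields, `Sum.inl X` is the index of
`ψ(X)` and `Sum.inr X` that of `ψ̄(X)`; for the sources, `Sum.inl X` is the index of `η(X)` and
`Sum.inr X` that of `η̄(X)`. -/

variable {𝕏 : Type*}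

/-- The field `ψ(X)`. -/
def psi (X : 𝕏) : Grassmann (𝕏 ⊕ 𝕏) := gen (Sum.inl X)

/-- The field `ψ̄(X)`. -/
def psiBar (X : 𝕏) : Grassmann (𝕏 ⊕ 𝕏) := gen (Sum.inr X)

/-- The source `η(X)`. -/
def eta (X : 𝕏) : Grassmann (𝕏 ⊕ 𝕏) := gen (Sum.inl X)

/-- The source `η̄(X)`. -/
def etaBar (X : 𝕏) : Grassmann (𝕏 ⊕ 𝕏) := gen (Sum.inr X)

/-- The right-hand side `exp (η̄, C η)` of the identity
`⟨exp ((η̄, ψ) + (ψ̄, η))⟩ = exp (η̄, C η)` that defines the Gaussian expectation. -/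
def generatingFunction [Fintype 𝕏] (C : 𝕏 → 𝕏 → ℂ) : Grassmann (𝕏 ⊕ 𝕏) :=
  IsNilpotent.exp (∑ X, ∑ Y, C X Y • (etaBar X * eta Y))

/-- The linear map that sends `ψ(X)` to the coordinate dual to `η̄(X)`, and `ψ̄(X)` to minus the
coordinate dual to `η(X)`. -/
def sourceDual : ((𝕏 ⊕ 𝕏) →₀ ℂ) →ₗ[ℂ] Module.Dual ℂ ((𝕏 ⊕ 𝕏) →₀ ℂ) :=
  Finsupp.linearCombination ℂ (Sum.elim
    (fun X => Finsupp.lapply (Sum.inr X))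
    (fun X => -Finsupp.lapply (Sum.inl X)))

/-- Substitution of source derivatives for the fields: the algebra homomorphism with
`ψ(X) ↦ δ/δη̄(X)` and `ψ̄(X) ↦ -δ/δη(X)`. (Contraction with a dual vector is the Grassmann
derivative, acting from the left.) Applied to `exp ((η̄, ψ) + (ψ̄, η))`, the derivatives
`δ/δη̄(X)` and `-δ/δη(X)` bring down the factors `ψ(X)` and `ψ̄(X)`. -/
def sourceDerivative : Grassmann (𝕏 ⊕ 𝕏) →ₐ[ℂ] Module.End ℂ (Grassmann (𝕏 ⊕ 𝕏)) :=
  ExteriorAlgebra.lift ℂ ⟨CliffordAlgebra.contractLeft ∘ₗ sourceDual, fun v =>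
    LinearMap.ext fun x => CliffordAlgebra.contractLeft_contractLeft (sourceDual v) x⟩

/-- The Gaussian expectation `⟨V⟩ = ∫ dμ_C(ψ) V(ψ)` with covariance `C`: the linear functional
on the Grassmann algebra of the fields with `⟨exp ((η̄, ψ) + (ψ̄, η))⟩ = exp (η̄, C η)`, read off
by taking derivatives of both sides with respect to the sources, at vanishing sources. -/
def gaussianExpectation [Fintype 𝕏] (C : 𝕏 → 𝕏 → ℂ) : Grassmann (𝕏 ⊕ 𝕏) →ₗ[ℂ] ℂ :=
  ExteriorAlgebra.algebraMapInv.toLinearMap ∘ₗ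
    LinearMap.applyₗ (generatingFunction C) ∘ₗ sourceDerivative.toLinearMap

/-- The monomial `ψ̄(Y 0) ⋯ ψ̄(Y (n-1)) ψ(X 0) ⋯ ψ(X (m-1))`. -/
def monomial {m n : ℕ} (Y : Fin n → 𝕏) (X : Fin m → 𝕏) : Grassmann (𝕏 ⊕ 𝕏) :=
  (List.ofFn fun j => psiBar (Y j)).prod * (List.ofFn fun i => psi (X i)).prod

/-! ### Connected correlations -/

/-- The connected correlation
`⟨V 0; …; V (p-1)⟩ = ∂^p/∂λ_0 ⋯ ∂λ_{p-1} log ⟨exp (∑ q, λ_q V q)⟩` at `λ = 0`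
(the field-independent part, that is, at `ψ = ψ̄ = 0`), for elements `V q` of the even
subalgebra without constant term. -/
def connectedCorrelation [Fintype 𝕏] (C : 𝕏 → 𝕏 → ℂ) {p : ℕ}
    (V : Fin p → Grassmann (𝕏 ⊕ 𝕏)) : ℂ :=
  iteratedFDeriv ℂ p
    (fun lam : Fin p → ℂ =>
      Complex.log (gaussianExpectation C (IsNilpotent.exp (∑ q, lam q • V q))))
    0 (fun q => Pi.single q 1)

/-! ### The minimal length of a connecting tree -/

/-- A choice of the end points of the lines of a graph `T` on `{0, …, p-1}`: every edge is
realised by a line from a `ψ`-index `(q, i)` to a `ψ̄`-index `(q', j)`, where `q` and `q'` are, in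
either order, the vertices that the edge joins. -/
def LineChoice {p : ℕ} (m n : Fin p → ℕ) (T : SimpleGraph (Fin p)) : Type :=
  {c : T.edgeSet → (Σ q, Fin (m q)) × (Σ q, Fin (n q)) //
    ∀ e : T.edgeSet, s((c e).1.1, (c e).2.1) = (e : Sym2 (Fin p))}

open Classical in
/-- The minimum, over all trees `T` on `{0, …, p-1}` and all choices of end points of its lines,
of the sum of the distances `d(X q i, Y q' j)` over the lines of `T`. It is `⊤` if no tree admits
such a choice. -/
def treeLength [PseudoMetricSpace 𝕏] {p : ℕ} {m n : Fin p → ℕ}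
    (X : (q : Fin p) → Fin (m q) → 𝕏) (Y : (q : Fin p) → Fin (n q) → 𝕏) : ℝ≥0∞ :=
  ⨅ (T : SimpleGraph (Fin p)) (_ : T.IsTree) (c : LineChoice m n T),
    ∑ e : T.edgeSet, edist (X (c.1 e).1.1 (c.1 e).1.2) (Y (c.1 e).2.1 (c.1 e).2.2)

open Classical in
/-- The factor `exp (-L / ℓ)`, with the value `0` at `L = ⊤`. -/
def decayFactor (L : ℝ≥0∞) (ℓ : ℝ) : ℝ :=
  if L = ⊤ then 0 else Real.exp (-L.toReal / ℓ)

end FermionicCumulant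

end

/-! The root, taken to be the last vertex, is joined to the others one line at a time. Each factor
of each monomial gets a Grassmann generator of its own, with the covariance pulled back
(`gaussianExpectation_exp`). The generating function then becomes multi-affine in the couplings,
with coefficients `Z B`. Writing `∂ log Z = (∂ Z) / Z` for the derivative in the root coupling
expresses the cumulant through `Z` and the coefficients `u` of `1 / Z`
(`exists_iteratedFDeriv_log_eq`). This is a `clusterCorrelation` whose cluster is the root vertex.

For a cluster `W` and a set `S` of remaining vertices, multiply the covariance across the cut by
`s`. At `s = 0` expectations factorize and `Z * (1 / Z) = 1` makes the correlation vanish. The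
`s`-derivative inserts one line from a leg of the cluster to a leg of some `j ∈ S` and absorbs `j`
into the cluster, which is again a correlation of the same kind with `S` smaller
(`hasDerivAt_clusterCorrelation`). After all vertices are absorbed, the lines form a spanning tree
and the unused legs form a single Gaussian expectation.

That expectation is, up to sign, a determinant or zero. The interpolated covariance remains a Gram
matrix with the same bound on its vectors (`IsGramCovariance.rescale`), so the Gram–Hadamard
inequality gives a factor `γ` per leg without any factorial (`IsGramCovariance.norm_expect_le`). The
lines also give `γ` per leg, and their remaining weights multiply to at most `ω ^ (p - 1)` times the
tree decay (`prod_lineWeight_le`).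

What is left is to count trees with choices of distinct legs, each weighted by its interpolation
integrals. By Cayley's formula with prescribed degrees the count is `(p - 2)!` times the coefficient
of `X ^ (p - 2)` in `∏ q, n q * (1 + X) ^ (n q - 1)`, where `n q` is the number of legs. Here no
trees are enumerated: `growthCount` satisfies, with equality, the differential recursion that the
correlations satisfy as an inequality (`hasDerivAt_growthCount`), and comparing derivatives proves
the bound (`prod_mul_norm_clusterCorrelation_le`). Estimating the coefficient by evaluation at `X =
1` and at `X = 1 / 2` yields the two bounds. -/

noncomputable section

namespace FermionicCumulant

open CliffordAlgebra (contractLeft contractLeft_ι_mul contractLeft_comm)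

/-! ### Contraction, Wick ordering and Gaussian expectation on an exterior algebra -/

section Wick

variable {M N : Type*} [AddCommGroup M] [Module ℂ M] [AddCommGroup N] [Module ℂ N]

/-- Left induction for the exterior algebra. -/
theorem exterior_left_induction {P : ExteriorAlgebra ℂ M → Prop}
    (one : P 1) (smul : ∀ (c : ℂ) x, P x → P (c • x))
    (add : ∀ x y, P x → P y → P (x + y))
    (ι_mul : ∀ m x, P x → P (ExteriorAlgebra.ι ℂ m * x)) (x : ExteriorAlgebra ℂ M) : P x := by
  induction x using CliffordAlgebra.left_induction with
  | algebraMap r => rw [Algebra.algebraMap_eq_smul_one]; exact smul r 1 one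
  | add x y hx hy => exact add x y hx hy
  | ι_mul x m hx => exact ι_mul m x hx

theorem contract_ι_mul (d : Module.Dual ℂ M) (m : M) (x : ExteriorAlgebra ℂ M) :
    contractLeft d (ExteriorAlgebra.ι ℂ m * x) =
      d m • x - ExteriorAlgebra.ι ℂ m * contractLeft d x :=
  contractLeft_ι_mul d m x

theorem contract_one (d : Module.Dual ℂ M) :
    contractLeft d (1 : ExteriorAlgebra ℂ M) = 0 :=
  CliffordAlgebra.contractLeft_one 0 d

/-- Contraction passes a right factor that it annihilates. -/
theorem contract_mul_of_contract_eq_zero (d : Module.Dual ℂ M) (x y : ExteriorAlgebra ℂ M)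
    (hy : contractLeft d y = 0) : contractLeft d (x * y) = contractLeft d x * y := by
  induction x using exterior_left_induction with
  | one => rw [one_mul, hy, contract_one, zero_mul]
  | smul c x hx => rw [smul_mul_assoc, map_smul, hx, map_smul, smul_mul_assoc]
  | add x x' hx hx' => rw [add_mul, map_add, hx, hx', map_add, add_mul]
  | ι_mul m x hx => rw [mul_assoc, contract_ι_mul, hx, contract_ι_mul, sub_mul, smul_mul_assoc,
      mul_assoc]

theorem contract_map (ρ : M →ₗ[ℂ] N) (d : Module.Dual ℂ N) (x : ExteriorAlgebra ℂ M) :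
    contractLeft d (ExteriorAlgebra.map ρ x) = ExteriorAlgebra.map ρ (contractLeft (d ∘ₗ ρ) x) := by
  induction x using exterior_left_induction with
  | one => rw [map_one, contract_one, contract_one, map_zero]
  | smul c x hx => rw [map_smul, map_smul, hx, map_smul, map_smul]
  | add x x' hx hx' => rw [map_add, map_add, hx, hx', map_add, map_add]
  | ι_mul m x hx => rw [map_mul, ExteriorAlgebra.map_apply_ι, contract_ι_mul, hx, contract_ι_mul,
      map_sub, map_smul, map_mul, ExteriorAlgebra.map_apply_ι, LinearMap.comp_apply]

/-- Wick ordering with the two-point function `(v, w) ↦ B v w - B w v`: every generator `v` is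
replaced by `v + ∑ w, (B v w - B w v) ∂/∂w`. -/
def wick (B : LinearMap.BilinForm ℂ M) : ExteriorAlgebra ℂ M →ₗ[ℂ] ExteriorAlgebra ℂ M :=
  CliffordAlgebra.changeForm (Q := 0) (Q' := 0) (B := B.flip - B) (by
    ext v; simp [LinearMap.BilinMap.toQuadraticMap_apply])

variable (B : LinearMap.BilinForm ℂ M)

theorem wick_one : wick B 1 = 1 := CliffordAlgebra.changeForm_one _

theorem wick_ι_mul (v : M) (x : ExteriorAlgebra ℂ M) :
    wick B (ExteriorAlgebra.ι ℂ v * x) =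
      ExteriorAlgebra.ι ℂ v * wick B x + contractLeft (B v - B.flip v) (wick B x) := by
  have h : B v - B.flip v = -((B.flip - B) v) := by
    rw [LinearMap.sub_apply, neg_sub]
  rw [h, map_neg, LinearMap.neg_apply, ← sub_eq_add_neg]
  exact CliffordAlgebra.changeForm_ι_mul _ v x

theorem wick_contract (d : Module.Dual ℂ M) (x : ExteriorAlgebra ℂ M) :
    wick B (contractLeft d x) = contractLeft d (wick B x) :=
  CliffordAlgebra.changeForm_contractLeft _ d x

theorem wick_map (ρ : N →ₗ[ℂ] M) (x : ExteriorAlgebra ℂ N) :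
    wick B (ExteriorAlgebra.map ρ x) = ExteriorAlgebra.map ρ (wick (B.compl₁₂ ρ ρ) x) := by
  induction x using exterior_left_induction with
  | one => rw [map_one, wick_one, wick_one, map_one]
  | smul c x hx => rw [map_smul, map_smul, hx, map_smul, map_smul]
  | add x x' hx hx' => rw [map_add, map_add, hx, hx', map_add, map_add]
  | ι_mul m x hx =>
    rw [map_mul, ExteriorAlgebra.map_apply_ι, wick_ι_mul, hx, wick_ι_mul, map_add, map_mul,
      ExteriorAlgebra.map_apply_ι, contract_map]
    rfl

/-- If the two-point function of `v` is annihilated by the right factor, Wick ordering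
factorizes. -/
theorem wick_list_mul (l : List M) (y : ExteriorAlgebra ℂ M)
    (hy : ∀ v ∈ l, contractLeft (B v - B.flip v) y = 0) :
    wick B ((l.map (ExteriorAlgebra.ι ℂ)).prod * y) =
      wick B (l.map (ExteriorAlgebra.ι ℂ)).prod * wick B y := by
  induction l with
  | nil => simp [wick_one]
  | cons v l ih =>
    have h0 : contractLeft (B v - B.flip v) (wick B y) = 0 := by
      rw [← wick_contract, hy v (by simp), map_zero]
    rw [List.map_cons, List.prod_cons, mul_assoc, wick_ι_mul, wick_ι_mul,
      ih fun w hw => hy w (by simp [hw]), contract_mul_of_contract_eq_zero _ _ _ h0, add_mul,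
      mul_assoc]

/-- The Gaussian expectation with two-point function `(v, w) ↦ B v w - B w v`. -/
def expect : ExteriorAlgebra ℂ M →ₗ[ℂ] ℂ :=
  ExteriorAlgebra.algebraMapInv.toLinearMap ∘ₗ wick B

theorem expect_apply (x : ExteriorAlgebra ℂ M) :
    expect B x = ExteriorAlgebra.algebraMapInv (wick B x) := rfl

theorem algebraMapInv_ι (v : M) :
    ExteriorAlgebra.algebraMapInv (ExteriorAlgebra.ι ℂ v) = (0 : ℂ) := by
  simp [ExteriorAlgebra.algebraMapInv]

theorem expect_one : expect B 1 = 1 := by rw [expect_apply, wick_one, map_one]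

/-- Integration by parts: after Wick ordering, the term with `v` still standing on the left has no
constant part, so only the contraction survives. -/
theorem expect_ι_mul (v : M) (x : ExteriorAlgebra ℂ M) :
    expect B (ExteriorAlgebra.ι ℂ v * x) = expect B (contractLeft (B v - B.flip v) x) := by
  rw [expect_apply, wick_ι_mul, map_add, map_mul, algebraMapInv_ι, zero_mul, zero_add,
    ← wick_contract, expect_apply]

theorem algebraMapInv_map (ρ : N →ₗ[ℂ] M) (x : ExteriorAlgebra ℂ N) :
    ExteriorAlgebra.algebraMapInv (ExteriorAlgebra.map ρ x) =
      (ExteriorAlgebra.algebraMapInv x : ℂ) := by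
  have : (ExteriorAlgebra.algebraMapInv (R := ℂ)).comp (ExteriorAlgebra.map ρ) =
      (ExteriorAlgebra.algebraMapInv : ExteriorAlgebra ℂ N →ₐ[ℂ] ℂ) := by
    apply ExteriorAlgebra.hom_ext
    ext v
    simp [algebraMapInv_ι]
  exact DFunLike.congr_fun this x

/-- Substituting generators only pulls back the covariance. This is what permits a separate
generator for every leg, even when several legs sit at the same point. -/
theorem expect_map (ρ : N →ₗ[ℂ] M) (x : ExteriorAlgebra ℂ N) :
    expect B (ExteriorAlgebra.map ρ x) = expect (B.compl₁₂ ρ ρ) x := by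
  rw [expect_apply, wick_map, algebraMapInv_map, expect_apply]

end Wick

/-! ### Even elements: commutation and the derivation property -/

section Even

variable {M : Type*} [AddCommGroup M] [Module ℂ M]

theorem ι_mul_ι (u v : M) : ExteriorAlgebra.ι ℂ u * ExteriorAlgebra.ι ℂ v =
    -(ExteriorAlgebra.ι ℂ v * ExteriorAlgebra.ι ℂ u) :=
  eq_neg_of_add_eq_zero_left (ExteriorAlgebra.ι_add_mul_swap u v)

theorem ι_mul_ι_mul (u v : M) (x : ExteriorAlgebra ℂ M) :
    ExteriorAlgebra.ι ℂ u * (ExteriorAlgebra.ι ℂ v * x) =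
    -(ExteriorAlgebra.ι ℂ v * (ExteriorAlgebra.ι ℂ u * x)) := by
  rw [← mul_assoc, ι_mul_ι, neg_mul, mul_assoc]

theorem commute_of_commute_ι (q : ExteriorAlgebra ℂ M)
    (h : ∀ v, Commute q (ExteriorAlgebra.ι ℂ v)) (x : ExteriorAlgebra ℂ M) : Commute q x := by
  induction x using exterior_left_induction with
  | one => exact Commute.one_right q
  | smul c x hx => exact hx.smul_right c
  | add x y hx hy => exact hx.add_right hy
  | ι_mul v x hx => exact (h v).mul_right hx

theorem commute_ι_mul_ι (u v : M) (x : ExteriorAlgebra ℂ M) :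
    Commute (ExteriorAlgebra.ι ℂ u * ExteriorAlgebra.ι ℂ v) x := by
  refine commute_of_commute_ι _ (fun w => ?_) x
  rw [Commute, SemiconjBy, mul_assoc, ι_mul_ι v w, mul_neg, ι_mul_ι_mul u w, neg_neg]

/-- Contraction acts as a derivation on the products with even elements of degree two. -/
theorem contract_pair_mul (d : Module.Dual ℂ M) (u v : M) (x : ExteriorAlgebra ℂ M) :
    contractLeft d (ExteriorAlgebra.ι ℂ u * ExteriorAlgebra.ι ℂ v * x) =
      contractLeft d (ExteriorAlgebra.ι ℂ u * ExteriorAlgebra.ι ℂ v) * x +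
      ExteriorAlgebra.ι ℂ u * ExteriorAlgebra.ι ℂ v * contractLeft d x := by
  have h : contractLeft d (ExteriorAlgebra.ι ℂ v) = d v • (1 : ExteriorAlgebra ℂ M) := by
    have := contract_ι_mul d v 1
    rwa [mul_one, contract_one, mul_zero, sub_zero] at this
  rw [mul_assoc, contract_ι_mul, contract_ι_mul, contract_ι_mul, h]
  simp only [mul_sub, sub_mul, smul_mul_assoc, mul_smul_comm, mul_one, mul_assoc]
  abel

/-- Contraction acts on `y * x` if it acts on `x` as multiplication by a generator. -/
theorem contract_mul_of_contract_eq_ι_mul (d : Module.Dual ℂ M) (w : M)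
    (x y : ExteriorAlgebra ℂ M) (hx : contractLeft d x = ExteriorAlgebra.ι ℂ w * x) :
    contractLeft d (y * x) = (contractLeft d y + ExteriorAlgebra.ι ℂ w * y) * x := by
  induction y using exterior_left_induction with
  | one => rw [one_mul, hx, contract_one, zero_add, mul_one]
  | smul c y hy => rw [smul_mul_assoc, map_smul, hy, map_smul, mul_smul_comm, ← smul_add,
      smul_mul_assoc]
  | add y z hy hz => rw [add_mul, map_add, hy, hz, map_add]; noncomm_ring
  | ι_mul v y hy =>
    rw [mul_assoc, contract_ι_mul, hy, contract_ι_mul, ι_mul_ι_mul w v]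
    simp only [add_mul, mul_add, sub_mul, smul_mul_assoc, neg_mul, mul_assoc]
    abel

end Even

/-- The bilinear form with matrix `A`. -/
def matForm {Λ : Type*} (A : Λ → Λ → ℂ) : LinearMap.BilinForm ℂ (Λ →₀ ℂ) :=
  Finsupp.linearCombination ℂ fun a => Finsupp.linearCombination ℂ (A a)

theorem matForm_single {Λ : Type*} (A : Λ → Λ → ℂ) (a b : Λ) :
    matForm A (Finsupp.single a 1) (Finsupp.single b 1) = A a b := by
  simp [matForm]

variable {𝕏 : Type*}

/-- The matrix of the covariance on the fields. -/
def fieldCov (C : 𝕏 → 𝕏 → ℂ) : 𝕏 ⊕ 𝕏 → 𝕏 ⊕ 𝕏 → ℂ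
  | Sum.inl X, Sum.inr Y => C X Y
  | _, _ => 0

/-! ### The Gaussian expectation defined by sources is the Wick expectation -/

section Gaussian

variable [Fintype 𝕏] (C : 𝕏 → 𝕏 → ℂ)

/-- The sources coupled to the fields after integration. -/
def coupledSource : ((𝕏 ⊕ 𝕏) →₀ ℂ) →ₗ[ℂ] ((𝕏 ⊕ 𝕏) →₀ ℂ) :=
  Finsupp.linearCombination ℂ (Sum.elim
    (fun X => ∑ Y, C X Y • Finsupp.single (Sum.inl Y) 1)
    (fun Y => ∑ X, C X Y • Finsupp.single (Sum.inr X) 1))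

/-- The exponent `(η̄, C η)` of the generating function. -/
def sourceForm : Grassmann (𝕏 ⊕ 𝕏) := ∑ X, ∑ Y, C X Y • (etaBar X * eta Y)

theorem contract_sourceForm_mul (d : Module.Dual ℂ ((𝕏 ⊕ 𝕏) →₀ ℂ)) (x : Grassmann (𝕏 ⊕ 𝕏)) :
    contractLeft d (sourceForm C * x) =
      contractLeft d (sourceForm C) * x + sourceForm C * contractLeft d x := by
  simp only [sourceForm, Finset.sum_mul, map_sum, smul_mul_assoc, map_smul, etaBar, eta, gen,
    contract_pair_mul, smul_add, Finset.sum_add_distrib]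

theorem commute_sourceForm (x : Grassmann (𝕏 ⊕ 𝕏)) : Commute (sourceForm C) x :=
  Commute.sum_left _ _ _ fun _ _ => Commute.sum_left _ _ _ fun _ _ =>
    (commute_ι_mul_ι _ _ _).smul_left _

theorem isNilpotent_sourceForm : IsNilpotent (sourceForm C) := by
  have hc : ∀ X Y (x : Grassmann (𝕏 ⊕ 𝕏)), Commute (C X Y • (etaBar X * eta Y)) x :=
    fun X Y x => (commute_ι_mul_ι _ _ _).smul_left _
  have h : ∀ X Y, IsNilpotent (C X Y • (etaBar X * eta Y)) := by
    intro X Y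
    refine ⟨2, ?_⟩
    have : etaBar X * eta Y * (etaBar X * eta Y) = 0 := by
      rw [etaBar, eta, gen, gen, mul_assoc, ι_mul_ι_mul (Finsupp.single (Sum.inl Y) 1),
        ExteriorAlgebra.ι_sq_zero]
      simp
    rw [pow_two, smul_mul_smul_comm, this, smul_zero]
  refine Commute.isNilpotent_sum (fun X _ => Commute.isNilpotent_sum (fun Y _ => h X Y) ?_) ?_
  · intro Y Z _ _; exact hc X Y _
  · intro X Z _ _; exact Commute.sum_left _ _ _ fun Y _ => hc X Y _

/-- The chain rule for the exponential: the exponent is central and contraction acts on its powers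
as a derivation. -/
theorem contract_generatingFunction (d : Module.Dual ℂ ((𝕏 ⊕ 𝕏) →₀ ℂ)) :
    contractLeft d (generatingFunction C) =
      contractLeft d (sourceForm C) * generatingFunction C := by
  obtain ⟨k, hk⟩ := isNilpotent_sourceForm C
  have hpow : ∀ i : ℕ, contractLeft d (sourceForm C ^ (i + 1)) =
      ((i : ℂ) + 1) • (contractLeft d (sourceForm C) * sourceForm C ^ i) := by
    intro i
    induction i with
    | zero => simp
    | succ i ih =>
      rw [pow_succ', contract_sourceForm_mul, ih, mul_smul_comm, ← mul_assoc,
        (commute_sourceForm C _).eq, mul_assoc, ← pow_succ']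
      push_cast
      module
  have e1 : generatingFunction C =
      ∑ i ∈ Finset.range k, (i.factorial : ℂ)⁻¹ • sourceForm C ^ i := by
    rw [generatingFunction, ← sourceForm, IsNilpotent.exp_eq_sum hk]
    refine Finset.sum_congr rfl fun i _ => ?_
    rw [← Rat.cast_smul_eq_qsmul ℂ]
    push_cast; rfl
  -- The vanishing power is added to the series so that, after differentiation lowers the degree by
  -- one, exactly the truncation in `e1` is recovered.
  have e2 : generatingFunction C =
      ∑ i ∈ Finset.range (k + 1), (i.factorial : ℂ)⁻¹ • sourceForm C ^ i := by
    rw [Finset.sum_range_succ, hk, smul_zero, add_zero, e1]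
  conv_lhs => rw [e2]
  rw [Finset.sum_range_succ', map_add, map_sum, pow_zero, map_smul, contract_one, smul_zero,
    add_zero, e1, Finset.mul_sum]
  refine Finset.sum_congr rfl fun i _ => ?_
  rw [map_smul, hpow, smul_smul, mul_smul_comm, Nat.factorial_succ]
  congr 1
  push_cast
  have h1 : (i : ℂ) + 1 ≠ 0 := by exact_mod_cast i.succ_ne_zero
  have h2 : (i.factorial : ℂ) ≠ 0 := by exact_mod_cast i.factorial_ne_zero
  field_simp

theorem contract_sourceForm (v : (𝕏 ⊕ 𝕏) →₀ ℂ) :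
    contractLeft (sourceDual v) (sourceForm C) = ExteriorAlgebra.ι ℂ (coupledSource C v) := by
  classical
  have key : (contractLeft.flip (sourceForm C)) ∘ₗ sourceDual =
      ExteriorAlgebra.ι ℂ ∘ₗ coupledSource C := by
    have h : ∀ (d : Module.Dual ℂ ((𝕏 ⊕ 𝕏) →₀ ℂ)) (u w : (𝕏 ⊕ 𝕏) →₀ ℂ),
        contractLeft d (ExteriorAlgebra.ι ℂ u * ExteriorAlgebra.ι ℂ w) =
          d u • ExteriorAlgebra.ι ℂ w - d w • ExteriorAlgebra.ι ℂ u := by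
      intro d u w
      have := contract_ι_mul d w 1
      rw [mul_one, contract_one, mul_zero, sub_zero] at this
      rw [contract_ι_mul, this, mul_smul_comm, mul_one]
    ext a
    rcases a with X | Y
    · simp [sourceForm, coupledSource, sourceDual, etaBar, eta, gen, h, Finsupp.single_apply,
        Finset.smul_sum, ite_smul, smul_ite]
      exact Finset.sum_congr rfl fun x _ => by
        rw [← map_smul, Finsupp.smul_single, smul_eq_mul, mul_one]
    · simp [sourceForm, coupledSource, sourceDual, etaBar, eta, gen, h, Finsupp.single_apply]
      exact Finset.sum_congr rfl fun x _ => by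
        rw [← map_smul, Finsupp.smul_single, smul_eq_mul, mul_one]
  exact LinearMap.congr_fun key v

theorem sourceDual_coupledSource (v : (𝕏 ⊕ 𝕏) →₀ ℂ) :
    sourceDual v ∘ₗ coupledSource C = matForm (fieldCov C) v - (matForm (fieldCov C)).flip v := by
  classical
  have key : (LinearMap.lcomp ℂ ℂ (coupledSource C)) ∘ₗ sourceDual =
      matForm (fieldCov C) - (matForm (fieldCov C)).flip := by
    ext a b
    rcases a with X | X <;> rcases b with Y | Y <;>
      simp [sourceDual, coupledSource, matForm, fieldCov, Finsupp.single_apply]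
  exact LinearMap.congr_fun key v

/-- Each source derivative either acts on what earlier ones brought down, which is a Wick
contraction, or brings down a coupled source from the exponential. Induction on the number of fields
keeps the form (Wick-ordered polynomial in coupled sources) times (generating function), and setting
the sources to zero leaves the constant term. -/
theorem gaussianExpectation_eq_expect :
    gaussianExpectation C = expect (matForm (fieldCov C)) := by
  have h : ∀ W : Grassmann (𝕏 ⊕ 𝕏), sourceDerivative W (generatingFunction C) =
      ExteriorAlgebra.map (coupledSource C) (wick (matForm (fieldCov C)) W) *
        generatingFunction C := by
    intro W
    induction W using exterior_left_induction with
    | one => simp [wick_one]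
    | smul c x hx => simp only [map_smul, LinearMap.smul_apply, hx, smul_mul_assoc]
    | add x y hx hy => simp only [map_add, LinearMap.add_apply, hx, hy, add_mul]
    | ι_mul v x hx =>
      rw [map_mul, Module.End.mul_apply, hx]
      have : sourceDerivative (ExteriorAlgebra.ι ℂ v) = contractLeft (sourceDual v) := by
        simp [sourceDerivative]
      rw [this, contract_mul_of_contract_eq_ι_mul _ (coupledSource C v), contract_map,
        sourceDual_coupledSource, wick_ι_mul, map_add, map_mul, ExteriorAlgebra.map_apply_ι,
        add_comm]
      rw [contract_generatingFunction, contract_sourceForm]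
  have h1 : ExteriorAlgebra.algebraMapInv (generatingFunction C) = (1 : ℂ) := by
    rw [generatingFunction, ← sourceForm, IsNilpotent.map_exp (isNilpotent_sourceForm C)]
    simp [sourceForm, etaBar, gen, algebraMapInv_ι]
  refine LinearMap.ext fun W => ?_
  rw [expect_apply, gaussianExpectation]
  simp only [LinearMap.comp_apply, AlgHom.toLinearMap_apply, LinearMap.applyₗ_apply_apply, h,
    map_mul, h1, mul_one, algebraMapInv_map]

end Gaussian

/-! ### Monomials in the generators, up to sign -/

section Monomials

variable {Λ : Type*}

/-- The left derivative with respect to the generator with index `b`. -/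
def del (b : Λ) : Grassmann Λ →ₗ[ℂ] Grassmann Λ := contractLeft (Finsupp.lapply b)

theorem del_one (b : Λ) : del b (1 : Grassmann Λ) = 0 := contract_one _

theorem del_gen_mul [DecidableEq Λ] (b a : Λ) (x : Grassmann Λ) :
    del b (gen a * x) = (if a = b then x else 0) - gen a * del b x := by
  rw [del, gen, contract_ι_mul, Finsupp.lapply_apply, Finsupp.single_apply, ite_smul, one_smul,
    zero_smul]

theorem del_mul_of_del_eq_zero (b : Λ) (x y : Grassmann Λ) (hy : del b y = 0) :
    del b (x * y) = del b x * y :=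
  contract_mul_of_contract_eq_zero _ _ _ hy

theorem gen_mul_gen (a b : Λ) : gen a * gen b = -(gen b * gen a) := ι_mul_ι _ _

theorem grassmann_induction {P : Grassmann Λ → Prop}
    (one : P 1) (smul : ∀ (c : ℂ) x, P x → P (c • x))
    (add : ∀ x y, P x → P y → P (x + y))
    (gen_mul : ∀ a x, P x → P (gen a * x)) (x : Grassmann Λ) : P x := by
  induction x using exterior_left_induction with
  | one => exact one
  | smul c x hx => exact smul c x hx
  | add x y hx hy => exact add x y hx hy
  | ι_mul m x hx =>
    induction m using Finsupp.induction_linear with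
    | zero => simpa using smul 0 x hx
    | add m n hm hn => rw [map_add, add_mul]; exact add _ _ hm hn
    | single a c =>
      have : ExteriorAlgebra.ι ℂ (Finsupp.single a c) = c • gen a := by
        rw [gen, ← map_smul, Finsupp.smul_single, smul_eq_mul, mul_one]
      rw [this, smul_mul_assoc]
      exact smul _ _ (gen_mul a x hx)

/-- The product of the generators in a list. -/
def listMonomial (l : List Λ) : Grassmann Λ := (l.map gen).prod

theorem listMonomial_nil : listMonomial ([] : List Λ) = 1 := rfl

theorem listMonomial_cons (a : Λ) (l : List Λ) :
    listMonomial (a :: l) = gen a * listMonomial l := by simp [listMonomial]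

theorem listMonomial_append (l l' : List Λ) :
    listMonomial (l ++ l') = listMonomial l * listMonomial l' := by simp [listMonomial]

theorem listMonomial_perm {l l' : List Λ} (h : l.Perm l') :
    listMonomial l = listMonomial l' ∨ listMonomial l = -listMonomial l' := by
  induction h with
  | nil => exact Or.inl rfl
  | cons a _ ih =>
    rw [listMonomial_cons, listMonomial_cons]
    rcases ih with ih | ih <;> rw [ih] <;> simp
  | swap a b l =>
    right
    simp only [listMonomial_cons]
    rw [← mul_assoc, gen_mul_gen, neg_mul, mul_assoc]
  | trans _ _ ih1 ih2 =>
    rcases ih1 with h1 | h1 <;> rcases ih2 with h2 | h2 <;> rw [h1, h2] <;> simp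

theorem del_listMonomial_of_notMem (b : Λ) (l : List Λ) (hb : b ∉ l) :
    del b (listMonomial l) = 0 := by
  classical
  induction l with
  | nil => exact del_one b
  | cons a l ih =>
    simp only [List.mem_cons, not_or] at hb
    rw [listMonomial_cons, del_gen_mul, if_neg (Ne.symm hb.1), ih hb.2, mul_zero, sub_zero]

theorem commute_listMonomial_gen (l : List Λ) (a : Λ) :
    listMonomial l * gen a = (-1 : ℂ) ^ l.length • (gen a * listMonomial l) := by
  induction l with
  | nil => simp [listMonomial]
  | cons b l ih =>
    rw [listMonomial_cons, mul_assoc, ih, mul_smul_comm, ← mul_assoc, gen_mul_gen b a,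
      List.length_cons, pow_succ]
    simp [mul_assoc]

theorem commute_listMonomial (l : List Λ) (hl : Even l.length) (x : Grassmann Λ) :
    Commute (listMonomial l) x := by
  induction x using grassmann_induction with
  | one => exact Commute.one_right _
  | smul c x hx => exact hx.smul_right c
  | add x y hx hy => exact hx.add_right hy
  | gen_mul a x hx =>
    refine Commute.mul_right ?_ hx
    rw [Commute, SemiconjBy, commute_listMonomial_gen, hl.neg_one_pow, one_smul]

variable [DecidableEq Λ]

/-- `W` is, up to the sign, the product of the generators with indices in `F`, in some order. -/
def IsSignedMonomial (F : Finset Λ) (W : Grassmann Λ) : Prop :=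
  ∃ l : List Λ, l.Nodup ∧ l.toFinset = F ∧ (W = listMonomial l ∨ W = -listMonomial l)

theorem isSignedMonomial_listMonomial (l : List Λ) (hl : l.Nodup) :
    IsSignedMonomial l.toFinset (listMonomial l) := ⟨l, hl, rfl, Or.inl rfl⟩

theorem IsSignedMonomial.mul {F F' : Finset Λ} {W W' : Grassmann Λ} (h : IsSignedMonomial F W)
    (h' : IsSignedMonomial F' W') (hd : Disjoint F F') : IsSignedMonomial (F ∪ F') (W * W') := by
  obtain ⟨l, hl, rfl, hW⟩ := h
  obtain ⟨l', hl', rfl, hW'⟩ := h'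
  refine ⟨l ++ l', ?_, by simp, ?_⟩
  · rw [List.nodup_append']
    exact ⟨hl, hl', by simpa [List.disjoint_toFinset_iff_disjoint] using hd⟩
  · rw [listMonomial_append]
    rcases hW with rfl | rfl <;> rcases hW' with rfl | rfl <;> simp

/-- Reordering costs only a sign, so any convenient order of the legs may be used when norms are
estimated. -/
theorem IsSignedMonomial.exists_perm {F : Finset Λ} {W : Grassmann Λ} (h : IsSignedMonomial F W)
    (l : List Λ) (hl : l.Nodup) (hF : l.toFinset = F) :
    W = listMonomial l ∨ W = -listMonomial l := by
  obtain ⟨l', hl', rfl, hW⟩ := h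
  have hp : l'.Perm l := by
    rw [List.perm_ext_iff_of_nodup hl' hl]
    intro a
    rw [← List.mem_toFinset, ← hF, List.mem_toFinset]
  rcases listMonomial_perm hp with hs | hs <;> rcases hW with hW | hW <;> rw [hW, hs] <;> simp

theorem IsSignedMonomial.del {F : Finset Λ} {W : Grassmann Λ} (h : IsSignedMonomial F W)
    {a : Λ} (ha : a ∈ F) : IsSignedMonomial (F.erase a) (del a W) := by
  have hn : a ∉ (F.erase a).toList := by simp
  have := h.exists_perm (a :: (F.erase a).toList)
    (List.nodup_cons.2 ⟨hn, Finset.nodup_toList _⟩) (by simp [ha])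
  refine ⟨(F.erase a).toList, Finset.nodup_toList _, by simp, ?_⟩
  have hd : FermionicCumulant.del a (listMonomial (a :: (F.erase a).toList)) =
      listMonomial (F.erase a).toList := by
    rw [listMonomial_cons, del_gen_mul, if_pos rfl, del_listMonomial_of_notMem a _ hn, mul_zero,
      sub_zero]
  rcases this with h | h <;> rw [h]
  · left; exact hd
  · right; rw [map_neg, hd]

theorem IsSignedMonomial.del_eq_zero {F : Finset Λ} {W : Grassmann Λ} (h : IsSignedMonomial F W)
    {a : Λ} (ha : a ∉ F) : FermionicCumulant.del a W = 0 := by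
  obtain ⟨l, hl, rfl, hW⟩ := h
  have := del_listMonomial_of_notMem a l (by simpa using ha)
  rcases hW with rfl | rfl <;> simp [this]

end Monomials

/-! ### Interpolation of the covariance across a cut -/

section Interpolation

variable {Λ : Type*}

/-- The two-point function `⟨θ a θ b⟩` of the generators. -/
def twoPoint (A : Λ → Λ → ℂ) (a b : Λ) : ℂ := A a b - A b a

theorem twoPoint_swap (A : Λ → Λ → ℂ) (a b : Λ) : twoPoint A a b = -twoPoint A b a := by
  simp [twoPoint]

variable (p : Λ → Prop) [DecidablePred p]

/-- The covariance with the entries between `p` and its complement multiplied by `s`. -/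
def rescale (s : ℝ) (A : Λ → Λ → ℂ) (a b : Λ) : ℂ :=
  if (p a ↔ p b) then A a b else s * A a b

theorem rescale_one (A : Λ → Λ → ℂ) : rescale p 1 A = A := by
  funext a b; simp [rescale]

theorem twoPoint_rescale (s : ℝ) (A : Λ → Λ → ℂ) (a b : Λ) :
    twoPoint (rescale p s A) a b = if (p a ↔ p b) then twoPoint A a b else s * twoPoint A a b := by
  by_cases h : (p a ↔ p b)
  · simp [twoPoint, rescale, h]
  · have h' : ¬(p b ↔ p a) := fun h' => h h'.symm
    simp [twoPoint, rescale, h, h', mul_sub]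

variable [Fintype Λ]

theorem matForm_sub_flip_single (A : Λ → Λ → ℂ) (a : Λ) :
    matForm A (Finsupp.single a 1) - (matForm A).flip (Finsupp.single a 1) =
      ∑ b, twoPoint A a b • Finsupp.lapply b := by
  classical
  ext b
  simp [matForm_single, twoPoint, Finsupp.single_apply]

theorem contract_matForm_single (A : Λ → Λ → ℂ) (a : Λ) (x : Grassmann Λ) :
    contractLeft (matForm A (Finsupp.single a 1) - (matForm A).flip (Finsupp.single a 1)) x =
      ∑ b, twoPoint A a b • del b x := by
  rw [matForm_sub_flip_single, map_sum, LinearMap.sum_apply]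
  simp [del]

theorem wick_gen_mul (A : Λ → Λ → ℂ) (a : Λ) (x : Grassmann Λ) :
    wick (matForm A) (gen a * x) = gen a * wick (matForm A) x +
      ∑ b, twoPoint A a b • del b (wick (matForm A) x) := by
  rw [gen, wick_ι_mul, contract_matForm_single]

/-- No contraction can link the two factors. This is the decoupling that occurs at `s = 0`. -/
theorem expect_listMonomial_mul (A : Λ → Λ → ℂ) (l : List Λ) (y : Grassmann Λ)
    (h : ∀ a ∈ l, ∀ b, twoPoint A a b = 0 ∨ del b y = 0) :
    expect (matForm A) (listMonomial l * y) =
      expect (matForm A) (listMonomial l) * expect (matForm A) y := by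
  have e : listMonomial l =
      ((l.map fun a => Finsupp.single a (1 : ℂ)).map (ExteriorAlgebra.ι ℂ)).prod := by
    rw [listMonomial, List.map_map]; rfl
  rw [e, expect_apply, wick_list_mul, map_mul, ← expect_apply, ← expect_apply]
  intro v hv
  obtain ⟨a, ha, rfl⟩ := List.mem_map.1 hv
  rw [contract_matForm_single]
  refine Finset.sum_eq_zero fun b _ => ?_
  rcases h a ha b with h | h <;> simp [h]

/-- The second order differential operator of the two-point function between the complement
of `p` and `p`. -/
def crossDel (A : Λ → Λ → ℂ) : Grassmann Λ →ₗ[ℂ] Grassmann Λ :=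
  ∑ a with ¬p a, ∑ b with p b, twoPoint A a b • (del b ∘ₗ del a)

theorem crossDel_apply (A : Λ → Λ → ℂ) (x : Grassmann Λ) : crossDel p A x =
    ∑ a with ¬p a, ∑ b with p b, twoPoint A a b • del b (del a x) := by
  simp [crossDel, LinearMap.sum_apply]

/-- Commuting the second-order operator past a generator leaves a first-order one, in which `c` is
contracted across the cut. If `c` satisfies `p` it is the inner index of the double sum, and the
resulting minus sign is absorbed by the antisymmetry of `twoPoint`. -/
theorem crossDel_gen_mul (A : Λ → Λ → ℂ) (c : Λ) (x : Grassmann Λ) :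
    crossDel p A (gen c * x) = gen c * crossDel p A x +
      ∑ b, (if (p c ↔ p b) then 0 else twoPoint A c b) • del b x := by
  classical
  have h : ∀ a b, del b (del a (gen c * x)) = (if c = a then del b x else 0) -
      (if c = b then del a x else 0) + gen c * del b (del a x) := by
    intro a b
    rw [del_gen_mul, map_sub, del_gen_mul]
    split_ifs <;> (try rw [map_zero]) <;> abel
  simp only [crossDel_apply, h, smul_add, smul_sub, Finset.sum_add_distrib,
    Finset.sum_sub_distrib, Finset.mul_sum, mul_smul_comm]
  rw [add_comm]
  congr 1
  by_cases hc : p c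
  · rw [Finset.sum_eq_zero, zero_sub]
    · simp only [hc, true_iff, smul_ite, smul_zero, ite_smul, zero_smul, Finset.sum_filter]
      rw [← Finset.sum_neg_distrib]
      refine Finset.sum_congr rfl fun a _ => ?_
      by_cases ha : p a
      · simp [ha]
      · simp only [ha, not_false_eq_true, if_true, if_false]
        rw [Finset.sum_eq_single c]
        · simp [hc, twoPoint_swap A c a]
        · intro b _ hb; simp [Ne.symm hb]
        · simp
    · intro a ha
      refine Finset.sum_eq_zero fun b _ => ?_
      have : c ≠ a := by rintro rfl; simp [hc] at ha
      simp [this]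
  · rw [sub_eq_self.2]
    · simp only [hc, false_iff, smul_ite, smul_zero, ite_smul, zero_smul, Finset.sum_filter]
      rw [Finset.sum_eq_single c]
      · simp only [hc, not_false_eq_true, if_true]
        exact Finset.sum_congr rfl fun b _ => by by_cases hb : p b <;> simp [hb]
      · intro a _ ha; simp [Ne.symm ha]
      · simp
    · refine Finset.sum_eq_zero fun a _ => Finset.sum_eq_zero fun b hb => ?_
      have : c ≠ b := by rintro rfl; simp [hc] at hb
      simp [this]

/-- Wick ordering is formally the exponential of a second-order operator affine in `s`, so its
derivative applies the coefficient of `s`. The arbitrary functional `φ` makes the induction close: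
prepending a generator replaces `φ` by its compositions with left multiplication and with
derivatives. -/
theorem hasDerivAt_wick_rescale (A : Λ → Λ → ℂ) (s : ℝ) (x : Grassmann Λ)
    (φ : Grassmann Λ →ₗ[ℂ] ℂ) :
    HasDerivAt (fun s : ℝ => φ (wick (matForm (rescale p s A)) x))
      (φ (wick (matForm (rescale p s A)) (crossDel p A x))) s := by
  induction x using grassmann_induction generalizing φ with
  | one =>
    have : crossDel p A 1 = 0 := by simp [crossDel_apply, del_one]
    simp only [wick_one, this, map_zero]
    exact hasDerivAt_const _ _
  | smul c x hx =>
    simp only [map_smul]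
    exact (hx φ).const_smul c
  | add x y hx hy =>
    simp only [map_add]
    exact (hx φ).add (hy φ)
  | gen_mul a x hx =>
    have h2 : ∀ b, HasDerivAt (fun s : ℝ => twoPoint (rescale p s A) a b)
        (if (p a ↔ p b) then 0 else twoPoint A a b) s := by
      intro b
      simp only [twoPoint_rescale]
      split_ifs
      · exact hasDerivAt_const _ _
      · simpa using (Complex.ofRealCLM.hasDerivAt (x := s)).mul_const (twoPoint A a b)
    have h1 := (hx (φ ∘ₗ LinearMap.mulLeft ℂ (gen a))).add
      (HasDerivAt.fun_sum (u := Finset.univ) fun b _ => (h2 b).mul (hx (φ ∘ₗ del b)))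
    refine (h1.congr_deriv ?_).congr_of_eventuallyEq (Filter.Eventually.of_forall fun s => ?_)
    · rw [crossDel_gen_mul, map_add, wick_gen_mul]
      simp only [LinearMap.comp_apply, LinearMap.mulLeft_apply, map_add, map_sum, map_smul,
        smul_eq_mul, Finset.sum_add_distrib]
      rw [add_assoc, add_comm (∑ b, _ * _)]
      congr 2
      refine Finset.sum_congr rfl fun b _ => ?_
      rw [del, wick_contract]
    · simp [wick_gen_mul]

theorem hasDerivAt_expect_rescale (A : Λ → Λ → ℂ) (s : ℝ) (x : Grassmann Λ) :
    HasDerivAt (fun s : ℝ => expect (matForm (rescale p s A)) x)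
      (expect (matForm (rescale p s A)) (crossDel p A x)) s :=
  hasDerivAt_wick_rescale p A s x ExteriorAlgebra.algebraMapInv.toLinearMap

end Interpolation

/-! ### The determinant inequalities of Hadamard and Gram -/

section Hadamard

open Matrix
open scoped ComplexOrder

/-- Hadamard's inequality for rows of uniformly bounded length. -/
theorem norm_det_le_pow_of_row_le {n : ℕ} (P : Matrix (Fin n) (Fin n) ℂ) {γ : ℝ} (hγ : 0 < γ)
    (h : ∀ i, ∑ j, ‖P i j‖ ^ 2 ≤ γ ^ 2) : ‖P.det‖ ≤ γ ^ n := by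
  have hps : (P * Pᴴ).PosSemidef := Matrix.posSemidef_self_mul_conjTranspose P
  have hdet : ((‖P.det‖ ^ 2 : ℝ) : ℂ) = ((∏ i, hps.isHermitian.eigenvalues i : ℝ) : ℂ) := by
    have := hps.isHermitian.det_eq_prod_eigenvalues
    rw [Matrix.det_mul, Matrix.det_conjTranspose] at this
    rw [Complex.ofReal_prod]
    refine Eq.trans ?_ this
    rw [← Complex.normSq_eq_norm_sq, Complex.normSq_eq_conj_mul_self, mul_comm]
    rfl
  have hdet' := Complex.ofReal_injective hdet
  have htr : (∑ i, hps.isHermitian.eigenvalues i) = ∑ i, ∑ j, ‖P i j‖ ^ 2 := by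
    have := hps.isHermitian.trace_eq_sum_eigenvalues
    apply Complex.ofReal_injective
    rw [Complex.ofReal_sum]
    refine Eq.trans this.symm ?_
    simp only [Matrix.trace, Matrix.diag, Matrix.mul_apply, Matrix.conjTranspose_apply]
    push_cast
    refine Finset.sum_congr rfl fun i _ => Finset.sum_congr rfl fun j _ => ?_
    rw [← Complex.ofReal_pow, ← Complex.normSq_eq_norm_sq, Complex.normSq_eq_conj_mul_self,
      mul_comm]
    rfl
  have hγ2 : 0 < γ ^ 2 := by positivity
  have hle : (∏ i, hps.isHermitian.eigenvalues i) / (γ ^ 2) ^ n ≤ 1 := by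
    have e : (γ ^ 2) ^ n = ∏ _i : Fin n, γ ^ 2 := by simp
    rw [e, ← Finset.prod_div_distrib]
    -- The inequality of arithmetic and geometric means for the eigenvalues of `P * Pᴴ`, in the form
    -- `x ≤ exp (x - 1)` applied to each normalized eigenvalue; the trace bound makes the total
    -- exponent nonpositive.
    calc ∏ i, hps.isHermitian.eigenvalues i / γ ^ 2
        ≤ ∏ i, Real.exp (hps.isHermitian.eigenvalues i / γ ^ 2 - 1) := by
          refine Finset.prod_le_prod (fun i _ => ?_) fun i _ => ?_
          · exact div_nonneg (hps.eigenvalues_nonneg i) hγ2.le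
          · linarith [Real.add_one_le_exp (hps.isHermitian.eigenvalues i / γ ^ 2 - 1)]
      _ = Real.exp (∑ i, (hps.isHermitian.eigenvalues i / γ ^ 2 - 1)) := (Real.exp_sum _ _).symm
      _ ≤ 1 := by
          rw [Real.exp_le_one_iff, Finset.sum_sub_distrib, ← Finset.sum_div, htr]
          have : ∑ i, ∑ j, ‖P i j‖ ^ 2 ≤ ∑ _i : Fin n, γ ^ 2 := Finset.sum_le_sum fun i _ => h i
          have h2 : (∑ i, ∑ j, ‖P i j‖ ^ 2) / γ ^ 2 ≤ n := by
            rw [div_le_iff₀ hγ2]; simpa using this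
          simpa using h2
  rw [div_le_one (by positivity), ← hdet', ← pow_mul, mul_comm 2 n, pow_mul] at hle
  exact le_of_sq_le_sq hle (by positivity)

/-- Gram's inequality for vectors of uniformly bounded length. -/
theorem norm_det_gram_le {H : Type*} [NormedAddCommGroup H] [InnerProductSpace ℂ H] {n : ℕ}
    (f g : Fin n → H) {γ : ℝ} (hγ : 0 < γ) (hf : ∀ i, ‖f i‖ ≤ γ) (hg : ∀ i, ‖g i‖ ≤ γ) :
    ‖(Matrix.of fun i j => inner ℂ (f i) (g j)).det‖ ≤ γ ^ (2 * n) := by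
  -- For independent `g`, an orthonormal basis of their span factors the Gram matrix into two square
  -- matrices whose rows, respectively columns, are bounded by Bessel's inequality. For dependent
  -- `g` the determinant vanishes.
  by_cases hli : LinearIndependent ℂ g
  · let S := Submodule.span ℂ (Set.range g)
    have : FiniteDimensional ℂ S := FiniteDimensional.span_of_finite ℂ (Set.finite_range g)
    have hdim : Module.finrank ℂ S = n := by
      simpa using finrank_span_eq_card hli
    let b : OrthonormalBasis (Fin n) ℂ S := (stdOrthonormalBasis ℂ S).reindex (finCongr hdim)
    have hb : Orthonormal ℂ fun k => (b k : H) := b.orthonormal.comp_linearIsometry S.subtypeₗᵢ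
    have hmul : (Matrix.of fun i j => inner ℂ (f i) (g j)) =
        (Matrix.of fun i k => inner ℂ (f i) (b k : H)) *
        (Matrix.of fun k j => inner ℂ (b k : H) (g j)) := by
      ext i j
      have hgj : g j ∈ S := Submodule.subset_span ⟨j, rfl⟩
      have := congrArg (Subtype.val) (b.sum_repr' ⟨g j, hgj⟩)
      simp only [Submodule.coe_sum, Submodule.coe_smul, Submodule.coe_inner] at this
      rw [Matrix.mul_apply]
      simp only [Matrix.of_apply]
      conv_lhs => rw [← this]
      rw [inner_sum]
      exact Finset.sum_congr rfl fun k _ => by rw [inner_smul_right, mul_comm]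
    rw [hmul, Matrix.det_mul, norm_mul, two_mul, pow_add]
    refine mul_le_mul ?_ ?_ (norm_nonneg _) (by positivity)
    · refine norm_det_le_pow_of_row_le _ hγ fun i => ?_
      calc ∑ j, ‖inner ℂ (f i) (b j : H)‖ ^ 2 = ∑ j, ‖inner ℂ (b j : H) (f i)‖ ^ 2 :=
            Finset.sum_congr rfl fun j _ => by rw [norm_inner_symm]
        _ ≤ ‖f i‖ ^ 2 := hb.sum_inner_products_le (f i)
        _ ≤ γ ^ 2 := by gcongr; exact hf i
    · rw [← Matrix.det_transpose]
      refine norm_det_le_pow_of_row_le _ hγ fun i => ?_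
      calc ∑ j, ‖inner ℂ (b j : H) (g i)‖ ^ 2
          ≤ ‖g i‖ ^ 2 := hb.sum_inner_products_le (g i)
        _ ≤ γ ^ 2 := by gcongr; exact hg i
  · rw [Fintype.not_linearIndependent_iff] at hli
    obtain ⟨c, hc, i, hi⟩ := hli
    have : (Matrix.of fun i j => inner ℂ (f i) (g j)).det = 0 := by
      rw [← Matrix.exists_mulVec_eq_zero_iff]
      refine ⟨c, fun h => hi (congrFun h i), ?_⟩
      ext k
      have := congrArg (inner ℂ (f k)) hc
      rw [inner_sum, inner_zero_right] at this
      simp only [Matrix.mulVec, dotProduct, Matrix.of_apply, Pi.zero_apply]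
      rw [← this]
      exact Finset.sum_congr rfl fun k _ => by rw [inner_smul_right, mul_comm]
    rw [this, norm_zero]
    positivity

end Hadamard

/-! ### Wick's theorem as a determinant -/

section Contraction

variable {Λ : Type*}

theorem contract_listMonomial_mul_of_eq_zero (d : Module.Dual ℂ (Λ →₀ ℂ)) (l : List Λ)
    (y : Grassmann Λ) (h : ∀ a ∈ l, d (Finsupp.single a 1) = 0) :
    contractLeft d (listMonomial l * y) =
      (-1 : ℂ) ^ l.length • (listMonomial l * contractLeft d y) := by
  induction l with
  | nil => simp [listMonomial]
  | cons a l ih =>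
    rw [listMonomial_cons, mul_assoc, gen, contract_ι_mul, h a (by simp),
      ih fun b hb => h b (by simp [hb]), List.length_cons, pow_succ]
    simp [mul_assoc]

theorem contract_listMonomial_ofFn (d : Module.Dual ℂ (Λ →₀ ℂ)) {n : ℕ} (β : Fin (n + 1) → Λ) :
    contractLeft d (listMonomial (List.ofFn β)) =
      ∑ j : Fin (n + 1), ((-1 : ℂ) ^ (j : ℕ) * d (Finsupp.single (β j) 1)) •
        listMonomial (List.ofFn (β ∘ j.succAbove)) := by
  induction n with
  | zero =>
    have := contract_ι_mul d (Finsupp.single (β 0) 1) 1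
    simp [listMonomial, gen] at this ⊢
    exact this
  | succ n ih =>
    rw [List.ofFn_succ, listMonomial_cons, gen, contract_ι_mul, ih,
      Fin.sum_univ_succ (n := n + 1), Finset.mul_sum, sub_eq_add_neg, ← Finset.sum_neg_distrib]
    congr 1
    · simp [Function.comp_def]
    · refine Finset.sum_congr rfl fun j _ => ?_
      rw [List.ofFn_succ (f := β ∘ _), listMonomial_cons]
      simp [Function.comp_def, pow_succ, gen]

/-- Integrating the first generator by parts is Laplace expansion along the first row. Its
contraction must pass the remaining `κ`-generators, and these signs accumulate to the prefactor. -/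
theorem expect_listMonomial_ofFn [Fintype Λ] (A : Λ → Λ → ℂ) (κ : Λ → Prop)
    (h1 : ∀ a b, κ a → κ b → twoPoint A a b = 0) (n : ℕ) (α β : Fin n → Λ)
    (hα : ∀ i, κ (α i)) :
    expect (matForm A) (listMonomial (List.ofFn α) * listMonomial (List.ofFn β)) =
      (∏ i ∈ Finset.range n, (-1 : ℂ) ^ i) *
        (Matrix.of fun i j => twoPoint A (α i) (β j)).det := by
  induction n with
  | zero => simp [listMonomial, expect_one]
  | succ n ih =>
    have hd : ∀ a b, (matForm A (Finsupp.single a 1) - (matForm A).flip (Finsupp.single a 1))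
        (Finsupp.single b 1) = twoPoint A a b := by
      intro a b
      simp [matForm_single, twoPoint]
    rw [List.ofFn_succ (f := α), listMonomial_cons, gen, mul_assoc, expect_ι_mul,
      contract_listMonomial_mul_of_eq_zero, contract_listMonomial_ofFn, map_smul, Finset.mul_sum,
      map_sum]
    · simp only [mul_smul_comm, map_smul, smul_eq_mul, hd]
      rw [Matrix.det_succ_row_zero, Finset.prod_range_succ, List.length_ofFn, mul_comm (∏ _ ∈ _, _),
        mul_assoc, Finset.mul_sum _ _ (∏ _ ∈ _, _)]
      congr 1
      refine Finset.sum_congr rfl fun j _ => ?_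
      rw [ih _ _ fun i => hα _]
      simp only [Matrix.of_apply]
      have : (Matrix.of fun i k => twoPoint A (α (Fin.succ i)) ((β ∘ j.succAbove) k)) =
          (Matrix.of fun i k => twoPoint A (α i) (β k)).submatrix Fin.succ j.succAbove := rfl
      rw [this]
      ring
    · intro a ha
      obtain ⟨i, rfl⟩ := List.mem_ofFn.1 ha
      rw [hd]
      exact h1 _ _ (hα _) (hα _)

/-- Charge conservation: each contraction removes one generator of either kind, so an excess cannot
be paired. -/
theorem expect_listMonomial_ofFn_eq_zero [Fintype Λ] (A : Λ → Λ → ℂ) (κ : Λ → Prop)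
    (h1 : ∀ a b, (κ a ↔ κ b) → twoPoint A a b = 0) (n m : ℕ) (hnm : n ≠ m) (α : Fin n → Λ)
    (β : Fin m → Λ) (hα : ∀ i, κ (α i)) (hβ : ∀ i, ¬κ (β i)) :
    expect (matForm A) (listMonomial (List.ofFn α) * listMonomial (List.ofFn β)) = 0 := by
  have hd : ∀ a b, (matForm A (Finsupp.single a 1) - (matForm A).flip (Finsupp.single a 1))
      (Finsupp.single b 1) = twoPoint A a b := by
    intro a b
    simp [matForm_single, twoPoint]
  induction n generalizing m with
  | zero =>
    obtain ⟨m, rfl⟩ := Nat.exists_eq_succ_of_ne_zero hnm.symm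
    rw [List.ofFn_zero, listMonomial_nil, one_mul, List.ofFn_succ, listMonomial_cons, gen,
      expect_ι_mul, ← mul_one (listMonomial _), contract_listMonomial_mul_of_eq_zero, contract_one,
      mul_zero, smul_zero, map_zero]
    intro a ha
    obtain ⟨i, rfl⟩ := List.mem_ofFn.1 ha
    rw [hd]
    exact h1 _ _ (by simp [hβ])
  | succ n ih =>
    rw [List.ofFn_succ (f := α), listMonomial_cons, gen, mul_assoc, expect_ι_mul,
      contract_listMonomial_mul_of_eq_zero]
    · cases m with
      | zero => simp [listMonomial]
      | succ m =>
        rw [contract_listMonomial_ofFn, map_smul, Finset.mul_sum, map_sum,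
          Finset.sum_eq_zero, smul_zero]
        intro j _
        rw [mul_smul_comm, map_smul, ih m (by omega) (fun i => α i.succ) (β ∘ j.succAbove)
            (fun i => hα _)
          fun i => hβ _, smul_zero]
    · intro a ha
      obtain ⟨i, rfl⟩ := List.mem_ofFn.1 ha
      rw [hd]
      exact h1 _ _ (by simp [hα])

end Contraction

/-! ### Gram covariances: stability under interpolation and bounds on expectations -/

section Gram

universe u

variable {Λ : Type*} (κ : Λ → Prop) [DecidablePred κ]

/-- `A` is the covariance between the generators in `κ` and those outside `κ`, given by inner
products of vectors of length at most `γ`. -/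
def IsGramCovariance (γ : ℝ) (A : Λ → Λ → ℂ) : Prop :=
  ∃ (H : Type u) (_ : NormedAddCommGroup H) (_ : InnerProductSpace ℂ H) (f g : Λ → H),
    (∀ a, ‖f a‖ ≤ γ) ∧ (∀ a, ‖g a‖ ≤ γ) ∧
      ∀ a b, A a b = if κ a ∧ ¬κ b then inner ℂ (f a) (g b) else 0

variable {κ}

/-- The factor `1` within each side of the cut and `s` across it is the Gram matrix of the unit
vectors `(s, c)` and `(1, 0)` with `c ^ 2 = 1 - s ^ 2`. Tensoring with them keeps the lengths of the
original vectors. -/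
theorem IsGramCovariance.rescale {γ : ℝ} {A : Λ → Λ → ℂ} (h : IsGramCovariance.{u} κ γ A)
    (p : Λ → Prop) [DecidablePred p] {s : ℝ} (hs : s ∈ Set.Icc (0 : ℝ) 1) :
    IsGramCovariance.{u} κ γ (rescale p s A) := by
  obtain ⟨H, i1, i2, f, g, hf, hg, hA⟩ := h
  have hs2 : 0 ≤ 1 - s ^ 2 := by nlinarith [hs.1, hs.2]
  let c : ℝ := Real.sqrt (1 - s ^ 2)
  have hc : c ^ 2 = 1 - s ^ 2 := Real.sq_sqrt hs2
  let F : (Λ → H) → Λ → WithLp 2 (H × H) := fun f a =>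
    if p a then WithLp.toLp 2 ((s : ℂ) • f a, (c : ℂ) • f a) else WithLp.toLp 2 (f a, 0)
  have hF : ∀ f : Λ → H, (∀ a, ‖f a‖ ≤ γ) → ∀ a, ‖F f a‖ ≤ γ := by
    intro f hf a
    refine le_trans (le_of_eq ?_) (hf a)
    have : ‖F f a‖ ^ 2 = ‖f a‖ ^ 2 := by
      rw [WithLp.prod_norm_sq_eq_of_L2]
      by_cases ha : p a
      · simp only [F, if_pos ha, WithLp.toLp_fst, WithLp.toLp_snd, norm_smul,
          Complex.norm_real, Real.norm_eq_abs, mul_pow, sq_abs, hc]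
        ring
      · simp [F, if_neg ha]
    exact (sq_eq_sq₀ (norm_nonneg _) (norm_nonneg _)).1 this
  refine ⟨WithLp 2 (H × H), inferInstance, inferInstance, F f, F g, hF f hf, hF g hg, ?_⟩
  intro a b
  rw [FermionicCumulant.rescale, hA]
  by_cases hk : κ a ∧ ¬κ b
  · simp only [if_pos hk]
    rw [WithLp.prod_inner_apply]
    have hcc : (s : ℂ) * s + c * c = 1 := by
      have : s * s + c * c = 1 := by nlinarith [hc]
      exact_mod_cast this
    by_cases ha : p a <;> by_cases hb : p b <;>
      simp [F, ha, hb, inner_smul_left, inner_smul_right, -Complex.coe_smul]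
    rw [← mul_assoc, ← mul_assoc, ← add_mul, hcc, one_mul]
  · simp [hk]

theorem IsGramCovariance.norm_expect_le [Fintype Λ] [DecidableEq Λ] {γ : ℝ} (hγ : 0 < γ)
    {A : Λ → Λ → ℂ} (h : IsGramCovariance.{u} κ γ A) {F : Finset Λ} {W : Grassmann Λ}
    (hW : IsSignedMonomial F W) : ‖expect (matForm A) W‖ ≤ γ ^ F.card := by
  obtain ⟨H, i1, i2, f, g, hf, hg, hA⟩ := h
  have hdiag : ∀ a b, (κ a ↔ κ b) → twoPoint A a b = 0 := by
    intro a b hab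
    by_cases ha : κ a <;> simp [twoPoint, hA, ha, ← hab]
  let l₁ := (F.filter κ).toList
  let l₂ := (F.filter fun a => ¬κ a).toList
  have hl₁ : ∀ a ∈ l₁, κ a := fun a ha => by
    simpa using (Finset.mem_filter.1 (Finset.mem_toList.1 ha)).2
  have hl₂ : ∀ a ∈ l₂, ¬κ a := fun a ha => by
    simpa using (Finset.mem_filter.1 (Finset.mem_toList.1 ha)).2
  have hlen : l₁.length + l₂.length = F.card := by
    simp only [l₁, l₂, Finset.length_toList]
    exact Finset.card_filter_add_card_filter_not _
  have hWl := hW.exists_perm (l₁ ++ l₂) (by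
    rw [List.nodup_append']
    refine ⟨Finset.nodup_toList _, Finset.nodup_toList _, fun a h1 h2 => hl₂ a h2 (hl₁ a h1)⟩) (by
    ext a
    simp only [List.toFinset_append, Finset.mem_union, List.mem_toFinset, l₁, l₂,
      Finset.mem_toList, Finset.mem_filter]
    tauto)
  have hn : ‖expect (matForm A) W‖ = ‖expect (matForm A) (listMonomial l₁ * listMonomial l₂)‖ := by
    rw [← listMonomial_append]
    rcases hWl with h | h <;> simp [h]
  rw [hn, ← hlen]
  clear_value l₁ l₂
  obtain ⟨n, α, rfl⟩ : ∃ n, ∃ α : Fin n → Λ, l₁ = List.ofFn α := ⟨_, l₁.get, (List.ofFn_get _).symm⟩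
  obtain ⟨m, β, rfl⟩ : ∃ n, ∃ α : Fin n → Λ, l₂ = List.ofFn α := ⟨_, l₂.get, (List.ofFn_get _).symm⟩
  have hα : ∀ i, κ (α i) := fun i => hl₁ _ (List.mem_ofFn.2 ⟨i, rfl⟩)
  have hβ : ∀ i, ¬κ (β i) := fun i => hl₂ _ (List.mem_ofFn.2 ⟨i, rfl⟩)
  rcases eq_or_ne n m with rfl | hnm
  · rw [expect_listMonomial_ofFn A κ (fun a b ha hb => hdiag a b (by simp [ha, hb])) n α β hα,
      norm_mul]
    have h1 : ‖∏ i ∈ Finset.range n, (-1 : ℂ) ^ i‖ = 1 := by simp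
    have h2 : (Matrix.of fun i j => twoPoint A (α i) (β j)) =
        Matrix.of fun i j => inner ℂ ((f ∘ α) i) ((g ∘ β) j) := by
      ext i j
      simp [twoPoint, hA, hα, hβ]
    rw [h1, one_mul, h2]
    refine (norm_det_gram_le _ _ hγ (fun i => hf _) fun i => hg _).trans ?_
    simp [two_mul]
  · rw [expect_listMonomial_ofFn_eq_zero A κ hdiag n m hnm α β hα hβ, norm_zero]
    positivity

end Gram

/-! ### Mixed partial derivatives at the origin -/

section MixedDerivative

theorem analyticAt_coord {ι : Type*} [Fintype ι] (q : ι) (x : ι → ℂ) :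
    AnalyticAt ℂ (fun y : ι → ℂ => y q) x :=
  (ContinuousLinearMap.proj (R := ℂ) (φ := fun _ : ι => ℂ) q).analyticAt x

theorem analyticAt_prod_coord {ι : Type*} [Fintype ι] (B : Finset ι) (x : ι → ℂ) :
    AnalyticAt ℂ (fun y : ι → ℂ => ∏ q ∈ B, y q) x :=
  Finset.analyticAt_fun_prod _ fun q _ => analyticAt_coord q x

variable {ι : Type*} [DecidableEq ι]

/-- The partial derivative in the direction of the coordinate `q`. -/
def partialDeriv (q : ι) (g : (ι → ℂ) → ℂ) (x : ι → ℂ) : ℂ := fderiv ℂ g x (Pi.single q 1)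

/-- The iterated partial derivative at `0`; the head of the list is the first derivative taken. -/
def mixedDeriv : List ι → ((ι → ℂ) → ℂ) → ℂ
  | [], g => g 0
  | q :: l, g => mixedDeriv l (partialDeriv q g)

theorem partialDeriv_congr (q : ι) {g h : (ι → ℂ) → ℂ} (hgh : g =ᶠ[nhds 0] h) :
    partialDeriv q g =ᶠ[nhds 0] partialDeriv q h := by
  filter_upwards [hgh.fderiv (𝕜 := ℂ)] with x hx
  rw [partialDeriv, hx, partialDeriv]

theorem mixedDeriv_congr (l : List ι) {g h : (ι → ℂ) → ℂ} (hgh : g =ᶠ[nhds 0] h) :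
    mixedDeriv l g = mixedDeriv l h := by
  induction l generalizing g h with
  | nil => exact hgh.eq_of_nhds
  | cons q l ih => exact ih (partialDeriv_congr q hgh)

theorem mixedDeriv_zero (l : List ι) : mixedDeriv l (fun _ => 0) = 0 := by
  induction l with
  | nil => rfl
  | cons q l ih =>
    rw [mixedDeriv]
    refine Eq.trans (congrArg _ ?_) ih
    funext x
    simp [partialDeriv]

variable [Fintype ι]

theorem analyticAt_partialDeriv (q : ι) {g : (ι → ℂ) → ℂ} {x : ι → ℂ} (hg : AnalyticAt ℂ g x) :
    AnalyticAt ℂ (partialDeriv q g) x :=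
  ((ContinuousLinearMap.apply ℂ ℂ (Pi.single q (1 : ℂ) : ι → ℂ)).analyticAt _).comp hg.fderiv

theorem mixedDeriv_add (l : List ι) {g h : (ι → ℂ) → ℂ} (hg : AnalyticAt ℂ g 0)
    (hh : AnalyticAt ℂ h 0) :
    mixedDeriv l (fun x => g x + h x) = mixedDeriv l g + mixedDeriv l h := by
  induction l generalizing g h with
  | nil => rfl
  | cons q l ih =>
    rw [mixedDeriv, mixedDeriv, mixedDeriv,
      ← ih (analyticAt_partialDeriv q hg) (analyticAt_partialDeriv q hh)]
    refine mixedDeriv_congr l ?_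
    filter_upwards [hg.eventually_analyticAt, hh.eventually_analyticAt] with x hx hx'
    simp only [partialDeriv]
    rw [fderiv_fun_add hx.differentiableAt hx'.differentiableAt]
    rfl

theorem mixedDeriv_const_mul (l : List ι) (c : ℂ) {g : (ι → ℂ) → ℂ} (hg : AnalyticAt ℂ g 0) :
    mixedDeriv l (fun x => c * g x) = c * mixedDeriv l g := by
  induction l generalizing g with
  | nil => rfl
  | cons q l ih =>
    rw [mixedDeriv, mixedDeriv, ← ih (analyticAt_partialDeriv q hg)]
    refine mixedDeriv_congr l ?_
    filter_upwards [hg.eventually_analyticAt] with x hx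
    simp only [partialDeriv]
    rw [fderiv_const_mul hx.differentiableAt]
    rfl

theorem mixedDeriv_sum (l : List ι) {κ : Type*} (s : Finset κ) (g : κ → (ι → ℂ) → ℂ)
    (hg : ∀ k ∈ s, AnalyticAt ℂ (g k) 0) :
    mixedDeriv l (fun x => ∑ k ∈ s, g k x) = ∑ k ∈ s, mixedDeriv l (g k) := by
  classical
  induction s using Finset.induction_on with
  | empty => simpa using mixedDeriv_zero l
  | insert k s hk ih =>
    simp only [Finset.sum_insert hk]
    rw [mixedDeriv_add l (hg k (by simp)), ih fun j hj => hg j (by simp [hj])]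
    exact Finset.analyticAt_fun_sum _ fun j hj => hg j (by simp [hj])

/-- At the origin the factor `x q` survives only if it is differentiated, and since the list has no
repetitions this uses up the only derivative in that direction. -/
theorem mixedDeriv_coord_mul (l : List ι) (hl : l.Nodup) (q : ι) {g : (ι → ℂ) → ℂ}
    (hg : AnalyticAt ℂ g 0) :
    mixedDeriv l (fun x => x q * g x) =
      if q ∈ l then mixedDeriv (l.filter (· ≠ q)) g else 0 := by
  induction l generalizing g with
  | nil => simp [mixedDeriv]
  | cons a l ih =>
    have hcons := List.nodup_cons.1 hl
    have hpd : partialDeriv a (fun x => x q * g x) =ᶠ[nhds 0]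
        fun x => (if a = q then (1 : ℂ) else 0) * g x + x q * partialDeriv a g x := by
      filter_upwards [hg.eventually_analyticAt] with x hx
      have h1 := ((ContinuousLinearMap.proj (R := ℂ) (φ := fun _ : ι => ℂ) q).hasFDerivAt
        (x := x)).mul hx.differentiableAt.hasFDerivAt
      simp only [partialDeriv]
      rw [HasFDerivAt.fderiv (f := fun x : ι → ℂ => x q * g x) h1]
      by_cases haq : a = q
      · simp [haq]; ring
      · simp [haq, Ne.symm haq]
    rw [mixedDeriv, mixedDeriv_congr l hpd, mixedDeriv_add l (analyticAt_const.fun_mul hg)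
      ((analyticAt_coord q 0).fun_mul (analyticAt_partialDeriv a hg)), mixedDeriv_const_mul l _ hg,
      ih hcons.2 (analyticAt_partialDeriv a hg)]
    by_cases haq : a = q
    · subst haq
      have hf : l.filter (· ≠ a) = l :=
        List.filter_eq_self.2 fun b hb => by
          have : b ≠ a := fun h => hcons.1 (h ▸ hb)
          simpa using this
      rw [if_neg hcons.1, if_pos rfl, if_pos List.mem_cons_self, List.filter_cons,
        if_neg (by simp), hf, one_mul, add_zero]
    · have : q ≠ a := Ne.symm haq
      simp [haq, this, mixedDeriv]

theorem mixedDeriv_prod_mul (B : Finset ι) (l : List ι) (hl : l.Nodup) {g : (ι → ℂ) → ℂ}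
    (hg : AnalyticAt ℂ g 0) :
    mixedDeriv l (fun x => (∏ q ∈ B, x q) * g x) =
      if ∀ q ∈ B, q ∈ l then mixedDeriv (l.filter (· ∉ B)) g else 0 := by
  induction B using Finset.induction_on generalizing l with
  | empty => simp
  | insert q B hq ih =>
    simp only [Finset.prod_insert hq, mul_assoc]
    rw [mixedDeriv_coord_mul l hl q ((analyticAt_prod_coord B 0).fun_mul hg), ih _ (hl.filter _),
      List.filter_filter]
    have h1 : (∀ a ∈ B, a ∈ l.filter (· ≠ q)) ↔ ∀ a ∈ B, a ∈ l := by
      refine forall₂_congr fun a ha => ?_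
      have : a ≠ q := fun h => hq (h ▸ ha)
      simp [this]
    have h2 : (l.filter fun a => decide (a ∉ B) && decide (a ≠ q)) =
        l.filter fun a => a ∉ insert q B := by
      refine List.filter_congr fun a _ => ?_
      simp [Finset.mem_insert, not_or, Bool.and_comm]
    rw [h2]
    simp only [h1, Finset.mem_insert, forall_eq_or_imp, ite_and]

/-- `iteratedFDeriv` in coordinate directions is the iterated partial derivative. -/
theorem iteratedFDeriv_eq_mixedDeriv (n : ℕ) (v : Fin n → ι) {g : (ι → ℂ) → ℂ}
    (hg : AnalyticAt ℂ g 0) :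
    iteratedFDeriv ℂ n g 0 (fun i => Pi.single (v i) 1) = mixedDeriv (List.ofFn v).reverse g := by
  induction n generalizing g with
  | zero => simp [mixedDeriv]
  | succ n ih =>
    rw [iteratedFDeriv_succ_apply_right, List.ofFn_succ', List.concat_eq_append,
      List.reverse_append, List.reverse_singleton, List.singleton_append, mixedDeriv,
      ← ih (fun i => v i.castSucc) (analyticAt_partialDeriv _ hg)]
    have h := ContinuousLinearMap.iteratedFDeriv_comp_left (𝕜 := ℂ) (i := n)
      (ContinuousLinearMap.apply ℂ ℂ (Pi.single (v (Fin.last n)) (1 : ℂ)))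
      (hg.fderiv.contDiffAt (n := n)) le_rfl
    exact (congrArg (fun T => T fun i => Pi.single (v (Fin.castSucc i)) (1 : ℂ)) h).symm

theorem partialDeriv_prod_coord (B : Finset ι) (r : ι) (x : ι → ℂ) :
    partialDeriv r (fun y => ∏ q ∈ B, y q) x = if r ∈ B then ∏ q ∈ B.erase r, x q else 0 := by
  have h := HasFDerivAt.finsetProd (u := B) (g := fun q (y : ι → ℂ) => y q) (x := x)
    fun q _ => (ContinuousLinearMap.proj (R := ℂ) (φ := fun _ : ι => ℂ) q).hasFDerivAt
  rw [partialDeriv, h.fderiv]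
  simp [Pi.single_apply]

end MixedDerivative

/-! ### The rooted formula for the joint cumulant -/

section Cumulant

/-- The connected part of a multi-affine generating function with coefficients `Z`, rooted at the
last index, in terms of the coefficients `u` of the reciprocal of the generating function. -/
theorem exists_iteratedFDeriv_log_eq {n : ℕ} (Z : Finset (Fin (n + 1)) → ℂ) (hZ : Z ∅ = 1) :
    ∃ u : Finset (Fin (n + 1)) → ℂ,
      (∀ S, ∑ B ∈ S.powerset, Z B * u (S \ B) = if S = ∅ then 1 else 0) ∧
      iteratedFDeriv ℂ (n + 1)
        (fun x : Fin (n + 1) → ℂ => Complex.log (∑ B, (∏ q ∈ B, x q) * Z B)) 0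
        (fun q => Pi.single q 1) =
      ∑ B ∈ (Finset.univ.erase (Fin.last n)).powerset,
        Z (insert (Fin.last n) B) * u (Finset.univ.erase (Fin.last n) \ B) := by
  let f : (Fin (n + 1) → ℂ) → ℂ := fun x => ∑ B, (∏ q ∈ B, x q) * Z B
  have hfa : ∀ x, AnalyticAt ℂ f x := fun x =>
    Finset.analyticAt_fun_sum _ fun B _ => (analyticAt_prod_coord B x).fun_mul analyticAt_const
  have hf0 : f 0 = 1 := by
    simp only [f]
    rw [Finset.sum_eq_single ∅]
    · simp [hZ]
    · intro B _ hB
      obtain ⟨q, hq⟩ := Finset.nonempty_iff_ne_empty.2 hB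
      rw [Finset.prod_eq_zero hq rfl, zero_mul]
    · simp
  have hfinv : AnalyticAt ℂ (fun x => (f x)⁻¹) 0 := (hfa 0).inv (by simp [hf0])
  let r := Fin.last n
  let L : List (Fin (n + 1)) := (List.ofFn id).reverse
  have hL : L.Nodup := List.nodup_reverse.2 (List.nodup_ofFn.2 Function.injective_id)
  have hLm : ∀ q, q ∈ L := fun q => List.mem_reverse.2 (List.mem_ofFn.2 ⟨q, rfl⟩)
  let D : Finset (Fin (n + 1)) → ((Fin (n + 1) → ℂ) → ℂ) → ℂ := fun S g =>
    mixedDeriv (L.filter (· ∈ S)) g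
  have hD : ∀ S B (g : (Fin (n + 1) → ℂ) → ℂ), AnalyticAt ℂ g 0 →
      D S (fun x => (∏ q ∈ B, x q) * g x) = if B ⊆ S then D (S \ B) g else 0 := by
    intro S B g hg
    simp only [D]
    rw [mixedDeriv_prod_mul B _ (hL.filter _) hg, List.filter_filter]
    have h1 : (∀ q ∈ B, q ∈ L.filter (· ∈ S)) ↔ B ⊆ S := by
      simp [hLm, Finset.subset_iff]
    have h2 : (L.filter fun a => decide (a ∉ B) && decide (a ∈ S)) =
        L.filter (· ∈ S \ B) := by
      refine List.filter_congr fun a _ => ?_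
      simp [Finset.mem_sdiff, Bool.and_comm]
    simp only [h1, h2]
  -- `u` consists of the mixed derivatives of `1 / f` at the origin. The recursion is the Leibniz
  -- rule for `f * (1 / f) = 1`, valid near the origin.
  refine ⟨fun S => D S fun x => (f x)⁻¹, fun S => ?_, ?_⟩
  · have h1 : D S (fun x => ∑ B, Z B * ((∏ q ∈ B, x q) * (f x)⁻¹)) =
        if S = ∅ then 1 else 0 := by
      have hev : (fun x => ∑ B, Z B * ((∏ q ∈ B, x q) * (f x)⁻¹)) =ᶠ[nhds 0] fun _ => 1 := by
        filter_upwards [(hfa 0).continuousAt.eventually_ne (by simp [hf0] : f 0 ≠ 0)] with x hx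
        have : ∑ B, Z B * ((∏ q ∈ B, x q) * (f x)⁻¹) = f x * (f x)⁻¹ := by
          simp only [f]
          rw [Finset.sum_mul]
          exact Finset.sum_congr rfl fun B _ => by ring
        rw [this, mul_inv_cancel₀ hx]
      simp only [D]
      rw [mixedDeriv_congr _ hev]
      by_cases hS : S = ∅
      · simp [hS, mixedDeriv]
      · obtain ⟨q, hq⟩ := Finset.nonempty_iff_ne_empty.2 hS
        have hmem : q ∈ L.filter (· ∈ S) := by simp [hLm, hq]
        rw [if_neg hS]
        cases hl : L.filter (· ∈ S) with
        | nil => rw [hl] at hmem; simp at hmem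
        | cons a l =>
          rw [mixedDeriv]
          refine Eq.trans (congrArg _ ?_) (mixedDeriv_zero l)
          funext x
          simp [partialDeriv]
    rw [← h1]
    simp only [D]
    rw [mixedDeriv_sum _ _ (fun B x => Z B * ((∏ q ∈ B, x q) * (f x)⁻¹)) fun B _ => analyticAt_const.fun_mul
      ((analyticAt_prod_coord B 0).fun_mul hfinv)]
    have h2 : ∀ B, mixedDeriv (L.filter (· ∈ S)) (fun x => Z B * ((∏ q ∈ B, x q) * (f x)⁻¹)) =
        if B ⊆ S then Z B * D (S \ B) (fun x => (f x)⁻¹) else 0 := by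
      intro B
      rw [mixedDeriv_const_mul _ _ ((analyticAt_prod_coord B 0).fun_mul hfinv)]
      have := hD S B _ hfinv
      simp only [D] at this
      rw [this]
      simp [D]
    simp only [h2]
    rw [← Finset.sum_filter]
    refine Finset.sum_congr ?_ fun _ _ => rfl
    ext B; simp
  · have hlog : AnalyticAt ℂ (fun x => Complex.log (f x)) 0 :=
      (hfa 0).clog (by simp [hf0])
    -- The iterated derivative differentiates in the last direction first. This turns the logarithm
    -- into `(∂ f) / f` at once, so no higher derivative of the logarithm is needed.
    have hLr : L = r :: L.filter (· ∈ Finset.univ.erase r) := by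
      have h1 : L = r :: (List.ofFn (fun i : Fin n => i.castSucc)).reverse := by
        simp only [L]
        rw [List.ofFn_succ', List.concat_eq_append, List.reverse_append]
        rfl
      have h2 : L.filter (· ∈ Finset.univ.erase r) =
          (List.ofFn (fun i : Fin n => i.castSucc)).reverse := by
        rw [h1, List.filter_cons]
        simp only [Finset.mem_erase, Finset.mem_univ, and_true, ne_eq, not_true, decide_false]
        refine List.filter_eq_self.2 fun a ha => ?_
        rw [List.mem_reverse, List.mem_ofFn] at ha
        obtain ⟨i, rfl⟩ := ha
        exact decide_eq_true (Fin.castSucc_lt_last i).ne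
      rw [h2]; exact h1
    refine (iteratedFDeriv_eq_mixedDeriv (n + 1) id hlog).trans ?_
    change mixedDeriv L _ = _
    rw [hLr, mixedDeriv]
    have hev : partialDeriv r (fun x => Complex.log (f x)) =ᶠ[nhds 0] fun x =>
        ∑ B, (if r ∈ B then Z B else 0) * ((∏ q ∈ B.erase r, x q) * (f x)⁻¹) := by
      have hslit : ∀ᶠ x in nhds 0, f x ∈ Complex.slitPlane :=
        (hfa 0).continuousAt.eventually_mem (Complex.isOpen_slitPlane.mem_nhds (by simp [hf0]))
      filter_upwards [hslit] with x hx
      have hfd : HasFDerivAt f (fderiv ℂ f x) x := (hfa x).differentiableAt.hasFDerivAt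
      have hpf : fderiv ℂ f x (Pi.single r 1) =
          ∑ B, (if r ∈ B then ∏ q ∈ B.erase r, x q else 0) * Z B := by
        have h1 : HasFDerivAt f (∑ B, Z B • fderiv ℂ (fun y : Fin (n + 1) → ℂ => ∏ q ∈ B, y q) x) x :=
          HasFDerivAt.fun_sum fun B _ =>
            ((analyticAt_prod_coord B x).differentiableAt.hasFDerivAt.mul_const (Z B))
        rw [h1.fderiv, sum_apply]
        refine Finset.sum_congr rfl fun B _ => ?_
        have := partialDeriv_prod_coord B r x
        rw [partialDeriv] at this
        rw [smul_apply, this, smul_eq_mul, mul_comm]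
      rw [partialDeriv, (hfd.clog hx).fderiv, smul_apply, hpf, smul_eq_mul,
        Finset.mul_sum]
      refine Finset.sum_congr rfl fun B _ => ?_
      split_ifs <;> ring
    rw [mixedDeriv_congr _ hev, mixedDeriv_sum _ _
      (fun B x => (if r ∈ B then Z B else 0) * ((∏ q ∈ B.erase r, x q) * (f x)⁻¹)) fun B _ => analyticAt_const.fun_mul
      ((analyticAt_prod_coord _ 0).fun_mul hfinv)]
    have h2 : ∀ B, mixedDeriv (L.filter (· ∈ Finset.univ.erase r))
        (fun x => (if r ∈ B then Z B else 0) * ((∏ q ∈ B.erase r, x q) * (f x)⁻¹)) =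
        if r ∈ B then Z B * D (Finset.univ.erase r \ B.erase r) (fun x => (f x)⁻¹) else 0 := by
      intro B
      rw [mixedDeriv_const_mul _ _ ((analyticAt_prod_coord _ 0).fun_mul hfinv)]
      have := hD (Finset.univ.erase r) (B.erase r) _ hfinv
      rw [if_pos (Finset.erase_subset_erase r (Finset.subset_univ B))] at this
      simp only [D] at this
      rw [this]
      simp [D]
    simp only [h2]
    rw [← Finset.sum_filter]
    symm
    refine Finset.sum_bij (fun B _ => insert r B) ?_ ?_ ?_ ?_
    · intro B _; simp
    · intro B hB B' hB' h
      have e1 : r ∉ B := fun h => by simpa [r] using Finset.mem_powerset.1 hB h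
      have e2 : r ∉ B' := fun h => by simpa [r] using Finset.mem_powerset.1 hB' h
      rw [← Finset.erase_insert e1, h, Finset.erase_insert e2]
    · intro B hB
      refine ⟨B.erase r, Finset.mem_powerset.2 (Finset.erase_subset_erase r (Finset.subset_univ B)),
        Finset.insert_erase (Finset.mem_filter.1 hB).2⟩
    · intro B hB
      have e1 : r ∉ B := fun h => by simpa [r] using Finset.mem_powerset.1 hB h
      rw [Finset.erase_insert e1]

end Cumulant

/-! ### Counting trees with choices of legs by polynomials -/

section Counting

open Polynomial

variable {Λ ι : Type*} [DecidableEq Λ] [DecidableEq ι]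

/-- The generating polynomial of the choices of legs in `F` with weights `t`. -/
def legPoly (F : Finset Λ) (t : Λ → ℝ) : ℝ[X] := ∏ a ∈ F, (1 + C (t a) * X)

/-- The generating polynomial of the choices of legs at the vertices in `S`, with one leg
distinguished at each vertex. -/
def vertexPoly (n : ι → ℕ) (S : Finset ι) : ℝ[X] := ∏ q ∈ S, (C (n q : ℝ) * (1 + X) ^ (n q - 1))

/-- The weighted number of the ways to grow a tree over `M` vertices from a root with the leg
polynomial `E`. -/
def growthCount : ℕ → ℝ[X] → ℝ[X] → ℝ
  | 0, _, _ => 1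
  | M + 1, E, H => M.factorial * (derivative E * H).coeff M

omit [DecidableEq Λ] in
theorem legPoly_scale (F : Finset Λ) (t : Λ → ℝ) (s : ℝ) :
    legPoly F (fun a => s * t a) = (legPoly F t).comp (C s * X) := by
  rw [legPoly, legPoly, prod_comp]
  refine Finset.prod_congr rfl fun a _ => ?_
  simp only [add_comp, one_comp, mul_comp, C_comp, X_comp, C_mul]
  ring

theorem derivative_legPoly (F : Finset Λ) (t : Λ → ℝ) :
    derivative (legPoly F t) = ∑ a ∈ F, C (t a) * legPoly (F.erase a) t := by
  rw [legPoly, derivative_prod_finset]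
  refine Finset.sum_congr rfl fun a _ => ?_
  rw [derivative_add, derivative_one, zero_add, derivative_C_mul, derivative_X, mul_one, mul_comm,
    legPoly]

/-- The Leibniz rule, summed over which vertex has been absorbed into the cluster: `Q` is
differentiated once for every vertex, each vertex factor only once. -/
theorem sum_derivative_mul_vertexPoly (n : ι → ℕ) (S : Finset ι) (Q : ℝ[X]) :
    ∑ j ∈ S, derivative (Q * (C (n j : ℝ) * (1 + X) ^ (n j - 1))) * vertexPoly n (S.erase j) =
      (S.card : ℝ[X]) * (derivative Q * vertexPoly n S) + Q * derivative (vertexPoly n S) := by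
  have h : ∀ j ∈ S, derivative (Q * (C (n j : ℝ) * (1 + X) ^ (n j - 1))) *
      vertexPoly n (S.erase j) = derivative Q * vertexPoly n S +
        Q * ((∏ q ∈ S.erase j, (C (n q : ℝ) * (1 + X) ^ (n q - 1))) *
          derivative (C (n j : ℝ) * (1 + X) ^ (n j - 1))) := by
    intro j hj
    rw [derivative_mul]
    have : vertexPoly n S = (C (n j : ℝ) * (1 + X) ^ (n j - 1)) * vertexPoly n (S.erase j) :=
      (Finset.mul_prod_erase S _ hj).symm
    rw [this, vertexPoly]
    ring
  rw [Finset.sum_congr rfl h, Finset.sum_add_distrib, Finset.sum_const, nsmul_eq_mul,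
    ← Finset.mul_sum, vertexPoly, derivative_prod_finset]

/-- The differential recursion of the tree expansion, with equality. Choosing a line removes a leg
`a` of the cluster, at weight `t a`, and one of the `n j` legs of the new vertex; the other `n j -
1` legs join the cluster with weight `1`. -/
theorem hasDerivAt_growthCount (F : Finset Λ) (t : Λ → ℝ) (n : ι → ℕ) (S : Finset ι) (M : ℕ)
    (hS : S.card = M + 1) (s : ℝ) :
    HasDerivAt
      (fun s => growthCount (M + 1) (legPoly F (fun a => s * t a)) (vertexPoly n S))
      (∑ j ∈ S, n j * ∑ a ∈ F, t a * growthCount M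
        (legPoly (F.erase a) (fun a => s * t a) * (1 + X) ^ (n j - 1))
        (vertexPoly n (S.erase j))) s := by
  set c := derivative (legPoly F t) with hc
  set H := vertexPoly n S with hH
  have hB : ∀ s, growthCount (M + 1) (legPoly F (fun a => s * t a)) H =
      M.factorial * ∑ x ∈ Finset.HasAntidiagonal.antidiagonal M, s ^ (x.1 + 1) * (c.coeff x.1 * H.coeff x.2) := by
    intro s
    rw [growthCount, legPoly_scale, derivative_comp, coeff_mul]
    congr 1
    refine Finset.sum_congr rfl fun x _ => ?_
    rw [derivative_mul, derivative_C, zero_mul, zero_add, derivative_X, mul_one, coeff_C_mul,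
      comp_C_mul_X_coeff]
    ring
  have hQ : ∀ s, ∑ a ∈ F, C (t a) * legPoly (F.erase a) (fun a => s * t a) =
      c.comp (C s * X) := by
    intro s
    rw [hc, derivative_legPoly, sum_comp]
    refine Finset.sum_congr rfl fun a _ => ?_
    rw [legPoly_scale, mul_comp, C_comp]
  have hder : HasDerivAt (fun s => growthCount (M + 1) (legPoly F (fun a => s * t a)) H)
      (M.factorial * ∑ x ∈ Finset.HasAntidiagonal.antidiagonal M,
        ((x.1 + 1 : ℕ) * s ^ x.1) * (c.coeff x.1 * H.coeff x.2)) s := by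
    simp only [hB]
    refine HasDerivAt.const_mul _ (HasDerivAt.fun_sum fun x _ => ?_)
    simpa using (hasDerivAt_pow (x.1 + 1) s).mul_const (c.coeff x.1 * H.coeff x.2)
  refine hder.congr_deriv ?_
  -- When no vertex is left after this line, `growthCount` is `1` by definition and is not a
  -- coefficient, so this case is separate.
  cases M with
  | zero =>
    obtain ⟨j, rfl⟩ := Finset.card_eq_one.1 hS
    have h0 : H.coeff 0 = n j := by
      simp [hH, vertexPoly, coeff_zero_eq_eval_zero]
    have c0 : c.coeff 0 = ∑ a ∈ F, t a := by
      rw [hc, derivative_legPoly, finsetSum_coeff]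
      refine Finset.sum_congr rfl fun a _ => ?_
      simp [legPoly, coeff_zero_eq_eval_zero, eval_prod]
    simp [growthCount, h0, c0, mul_comm]
  | succ M =>
    have e1 : ∑ j ∈ S, (n j : ℝ) * ∑ a ∈ F, t a * growthCount (M + 1)
          (legPoly (F.erase a) (fun a => s * t a) * (1 + X) ^ (n j - 1))
          (vertexPoly n (S.erase j)) =
        M.factorial * (∑ j ∈ S, derivative (c.comp (C s * X) *
          (C (n j : ℝ) * (1 + X) ^ (n j - 1))) * vertexPoly n (S.erase j)).coeff M := by
      rw [finsetSum_coeff, Finset.mul_sum]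
      refine Finset.sum_congr rfl fun j _ => ?_
      rw [← hQ]
      have : (∑ a ∈ F, C (t a) * legPoly (F.erase a) (fun a => s * t a)) *
          (C (n j : ℝ) * (1 + X) ^ (n j - 1)) =
          C (n j : ℝ) * ∑ a ∈ F, C (t a) *
            (legPoly (F.erase a) (fun a => s * t a) * (1 + X) ^ (n j - 1)) := by
        rw [Finset.sum_mul, Finset.mul_sum]
        exact Finset.sum_congr rfl fun a _ => by ring
      rw [this, derivative_C_mul, derivative_sum, mul_assoc, coeff_C_mul, Finset.sum_mul,
        finsetSum_coeff, mul_left_comm]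
      congr 1
      rw [Finset.mul_sum]
      refine Finset.sum_congr rfl fun a _ => ?_
      rw [derivative_C_mul, mul_assoc, coeff_C_mul, growthCount]
      ring
    rw [e1, sum_derivative_mul_vertexPoly, ← hH, hS, coeff_add, Nat.factorial_succ]
    have e2 : (c.comp (C s * X) * derivative H).coeff M =
        ∑ x ∈ Finset.HasAntidiagonal.antidiagonal (M + 1), s ^ x.1 * (x.2 * (c.coeff x.1 * H.coeff x.2)) := by
      rw [coeff_mul, Finset.Nat.antidiagonal_succ']
      simp [comp_C_mul_X_coeff, coeff_derivative]
      refine Finset.sum_congr rfl fun x _ => ?_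
      ring
    have e3 : (derivative (c.comp (C s * X)) * H).coeff M =
        ∑ x ∈ Finset.HasAntidiagonal.antidiagonal (M + 1), s ^ x.1 * (x.1 * (c.coeff x.1 * H.coeff x.2)) := by
      rw [coeff_mul, Finset.Nat.antidiagonal_succ]
      simp [comp_C_mul_X_coeff, coeff_derivative]
      refine Finset.sum_congr rfl fun x _ => ?_
      ring
    have e4 : ((M + 1 + 1 : ℕ) : ℝ[X]) = C ((M + 1 + 1 : ℕ) : ℝ) := by simp
    rw [e4, coeff_C_mul, e2, e3, Finset.mul_sum _ _ ((M + 1 + 1 : ℕ) : ℝ),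
      ← Finset.sum_add_distrib]
    push_cast
    rw [mul_comm ((M : ℝ) + 1), mul_assoc, Finset.mul_sum _ _ ((M : ℝ) + 1)]
    congr 1
    refine Finset.sum_congr rfl fun x hx => ?_
    -- The two sides agree term by term because `(M + 2) * x.1 + x.2 = (M + 1) * (x.1 + 1)` whenever
    -- `x.1 + x.2 = M + 1`.
    have : (x.2 : ℝ) = M + 1 - x.1 := by
      have := Finset.HasAntidiagonal.mem_antidiagonal.1 hx
      have h2 : (x.1 : ℝ) + x.2 = M + 1 := by exact_mod_cast this
      linarith
    rw [this]
    ring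

omit [DecidableEq ι] in
theorem coeff_vertexPoly_mul_pow_le (n : ι → ℕ) (S : Finset ι) (k : ℕ) {x : ℝ} (hx : 0 ≤ x) :
    (vertexPoly n S).coeff k * x ^ k ≤ ∏ q ∈ S, (n q * (1 + x) ^ (n q - 1)) := by
  have h0 : ∀ i, 0 ≤ (vertexPoly n S).coeff i := by
    intro i
    have : vertexPoly n S = (∏ q ∈ S, (C (n q) * (1 + X) ^ (n q - 1)) : ℕ[X]).map
        (Nat.castRingHom ℝ) := by
      rw [vertexPoly, Polynomial.map_prod]
      simp
    rw [this, coeff_map]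
    exact Nat.cast_nonneg _
  have he : (vertexPoly n S).eval x = ∏ q ∈ S, (n q * (1 + x) ^ (n q - 1)) := by
    simp [vertexPoly, eval_prod]
  -- All coefficients are nonnegative, so one term is at most the value at `x`. The maximum in the
  -- range keeps the term `k` in the sum even beyond the degree.
  rw [← he, eval_eq_sum_range' (Nat.lt_succ_of_le (le_max_left (vertexPoly n S).natDegree k))]
  exact Finset.single_le_sum (f := fun i => (vertexPoly n S).coeff i * x ^ i)
    (fun i _ => mul_nonneg (h0 i) (pow_nonneg hx i))
    (Finset.mem_range.2 (Nat.lt_succ_of_le (le_max_right _ _)))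

theorem natCast_mul_two_pow_le (n : ℕ) : (n : ℝ) * (1 + 1) ^ (n - 1) ≤ 3 ^ n := by
  -- Passing from `n` to `n + 1` multiplies the left side by `2 * (n + 1) / n`, which is at most `3`
  -- exactly from `n = 2` on.
  obtain hn | hn := lt_or_ge n 2
  · interval_cases n <;> norm_num
  · obtain ⟨k, rfl⟩ := Nat.exists_eq_add_of_le hn
    rw [show 2 + k - 1 = k + 1 by omega]
    induction k with
    | zero => norm_num
    | succ k ih =>
      have ih := ih (by omega)
      have h1 : (0 : ℝ) < (1 + 1) ^ (k + 1) := by positivity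
      have hk : (0 : ℝ) ≤ k := Nat.cast_nonneg k
      push_cast at ih ⊢
      rw [pow_succ _ (k + 1), show 2 + (k + 1) = (2 + k) + 1 by ring, pow_succ (3 : ℝ)]
      nlinarith [mul_nonneg hk h1.le]

theorem natCast_mul_three_halves_pow_le (n : ℕ) :
    (n : ℝ) * (1 + 1 / 2) ^ (n - 1) ≤ 2 ^ n := by
  -- The ratio `3 / 2 * (n + 1) / n` is at most `2` exactly from `n = 3` on.
  obtain hn | hn := lt_or_ge n 3
  · interval_cases n <;> norm_num
  · obtain ⟨k, rfl⟩ := Nat.exists_eq_add_of_le hn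
    rw [show 3 + k - 1 = k + 2 by omega]
    induction k with
    | zero => norm_num
    | succ k ih =>
      have ih := ih (by omega)
      have h1 : (0 : ℝ) < (1 + 1 / 2) ^ (k + 2) := by positivity
      have hk : (0 : ℝ) ≤ k := Nat.cast_nonneg k
      push_cast at ih ⊢
      rw [show k + 1 + 2 = (k + 2) + 1 by ring, pow_succ, show 3 + (k + 1) = (3 + k) + 1 by ring,
        pow_succ (2 : ℝ)]
      nlinarith [mul_nonneg hk h1.le]

omit [DecidableEq ι] in
theorem coeff_vertexPoly_le_three_pow (n : ι → ℕ) (S : Finset ι) (k : ℕ) :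
    (vertexPoly n S).coeff k ≤ 3 ^ ∑ q ∈ S, n q := by
  have h := coeff_vertexPoly_mul_pow_le n S k zero_le_one
  rw [one_pow, mul_one] at h
  refine h.trans ?_
  rw [← Finset.prod_pow_eq_pow_sum]
  exact Finset.prod_le_prod (fun q _ => by positivity) fun q _ => natCast_mul_two_pow_le _

omit [DecidableEq ι] in
theorem coeff_vertexPoly_le_two_pow (n : ι → ℕ) (S : Finset ι) (k : ℕ) :
    (vertexPoly n S).coeff k ≤ 2 ^ k * 2 ^ ∑ q ∈ S, n q := by
  have h := coeff_vertexPoly_mul_pow_le n S k (x := 1 / 2) (by norm_num)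
  have h2 : ∏ q ∈ S, ((n q : ℝ) * (1 + 1 / 2) ^ (n q - 1)) ≤ 2 ^ ∑ q ∈ S, n q := by
    rw [← Finset.prod_pow_eq_pow_sum]
    exact Finset.prod_le_prod (fun q _ => by positivity) fun q _ =>
      natCast_mul_three_halves_pow_le _
  have h3 := h.trans h2
  rw [one_div, inv_pow, ← div_eq_mul_inv, div_le_iff₀ (by positivity)] at h3
  linarith

end Counting

/-! ### The exponential of commuting square-zero vertices -/

section Exponential

theorem isNilpotent_exp_sum_eq_prod {R ι : Type*} [CommRing R] [Algebra ℚ R] [DecidableEq ι]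
    (s : Finset ι) (v : ι → R) (hv : ∀ q, v q * v q = 0) :
    IsNilpotent.exp (∑ q ∈ s, v q) = ∏ q ∈ s, (1 + v q) := by
  have hn : ∀ q, IsNilpotent (v q) := fun q => ⟨2, by rw [pow_two, hv]⟩
  induction s using Finset.induction_on with
  | empty => simp [IsNilpotent.exp_zero]
  | insert q s hq ih =>
    have h1 : IsNilpotent.exp (v q) = 1 + v q := by
      rw [IsNilpotent.exp_eq_sum (k := 2) (by rw [pow_two, hv])]
      simp [Finset.sum_range_succ]
    rw [Finset.sum_insert hq, IsNilpotent.exp_add_of_commute (Commute.all _ _) (hn q)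
      (isNilpotent_sum fun i _ => hn i), ih, h1, Finset.prod_insert hq]

variable {Λ ι : Type*}

/-- The product of the vertices in `B`, in the Grassmann algebra. -/
def blockProd (V : ι → Subalgebra.center ℂ (Grassmann Λ)) (B : Finset ι) : Grassmann Λ :=
  ((∏ q ∈ B, V q : Subalgebra.center ℂ (Grassmann Λ)) : Grassmann Λ)

theorem blockProd_empty (V : ι → Subalgebra.center ℂ (Grassmann Λ)) : blockProd V ∅ = 1 := rfl

theorem blockProd_insert [DecidableEq ι] (V : ι → Subalgebra.center ℂ (Grassmann Λ))
    {B : Finset ι} {q : ι} (hq : q ∉ B) :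
    blockProd V (insert q B) = (V q : Grassmann Λ) * blockProd V B := by
  rw [blockProd, Finset.prod_insert hq]; rfl

theorem blockProd_eq_mul_erase [DecidableEq ι] (V : ι → Subalgebra.center ℂ (Grassmann Λ))
    {B : Finset ι} {q : ι} (hq : q ∈ B) :
    blockProd V B = (V q : Grassmann Λ) * blockProd V (B.erase q) := by
  rw [← blockProd_insert V (Finset.notMem_erase q B), Finset.insert_erase hq]

/-- In the center, a commutative ring, the exponential is a product of factors `1 + x q • V q`,
which expands over subsets. This is why the generating function is multi-affine. -/
theorem exp_sum_smul_eq [Fintype ι] [DecidableEq ι]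
    (V : ι → Subalgebra.center ℂ (Grassmann Λ)) (hV : ∀ q, V q * V q = 0) (x : ι → ℂ) :
    IsNilpotent.exp (∑ q, x q • (V q : Grassmann Λ)) =
      ∑ B : Finset ι, (∏ q ∈ B, x q) • blockProd V B := by
  let v : ι → Subalgebra.center ℂ (Grassmann Λ) := fun q => x q • V q
  have hv : ∀ q, v q * v q = 0 := fun q => by simp only [v]; rw [smul_mul_smul_comm, hV, smul_zero]
  have e1 : (∑ q, x q • (V q : Grassmann Λ)) =
      (Subalgebra.center ℂ (Grassmann Λ)).subtype (∑ q, v q) := by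
    rw [map_sum]; rfl
  have hn : IsNilpotent (∑ q, v q) := isNilpotent_sum fun i _ => ⟨2, by rw [pow_two, hv]⟩
  have e2 := IsNilpotent.map_exp hn (Subalgebra.center ℂ (Grassmann Λ)).val
  have e3 := isNilpotent_exp_sum_eq_prod Finset.univ v hv
  have e4 : IsNilpotent.exp (∑ q, x q • (V q : Grassmann Λ)) =
      (Subalgebra.center ℂ (Grassmann Λ)).val (∏ q, (1 + v q)) := by
    rw [← e3]
    exact (congrArg _ e1).trans e2.symm
  rw [e4, Finset.prod_one_add, map_sum, Finset.powerset_univ]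
  refine Finset.sum_congr rfl fun B _ => ?_
  simp only [v]
  rw [Finset.prod_smul, map_smul]
  rfl

theorem map_blockProd {Λ' : Type*} (ρ : Grassmann Λ →ₐ[ℂ] Grassmann Λ')
    (V : ι → Subalgebra.center ℂ (Grassmann Λ)) (V' : ι → Subalgebra.center ℂ (Grassmann Λ'))
    (h : ∀ q, ρ (V q) = V' q) (B : Finset ι) : ρ (blockProd V B) = blockProd V' B := by
  classical
  induction B using Finset.induction_on with
  | empty => simp [blockProd_empty]
  | insert q B hq ih => rw [blockProd_insert V hq, blockProd_insert V' hq, map_mul, h, ih]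

/-- The product of an even number of generators, as an element of the center. -/
def centralMonomial (l : List Λ) (hl : Even l.length) : Subalgebra.center ℂ (Grassmann Λ) :=
  ⟨listMonomial l, Subalgebra.mem_center_iff.2 fun x => (commute_listMonomial l hl x).eq.symm⟩

theorem centralMonomial_mul_self (l : List Λ) (hl : Even l.length) (h0 : 0 < l.length) :
    centralMonomial l hl * centralMonomial l hl = 0 := by
  apply Subtype.ext
  change listMonomial l * listMonomial l = 0
  cases l with
  | nil => simp at h0
  | cons a l =>
    conv_lhs => rhs; rw [listMonomial_cons]
    rw [← mul_assoc, (commute_listMonomial _ hl _).eq, listMonomial_cons, ← mul_assoc, gen,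
      ExteriorAlgebra.ι_sq_zero, zero_mul, zero_mul]

end Exponential

/-! ### Legs of the vertices -/

section Legs

variable {Λ ι : Type*} [Fintype Λ] [DecidableEq ι] (vtx : Λ → ι)

/-- The legs at the vertex `q`. -/
def legs (q : ι) : Finset Λ := Finset.univ.filter fun a => vtx a = q

theorem mem_legs {q : ι} {a : Λ} : a ∈ legs vtx q ↔ vtx a = q := by simp [legs]

variable [DecidableEq Λ] {vtx} {V : ι → Subalgebra.center ℂ (Grassmann Λ)}

theorem del_blockProd_eq_zero (hV : ∀ q, IsSignedMonomial (legs vtx q) (V q : Grassmann Λ))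
    {B : Finset ι} {b : Λ} (hb : vtx b ∉ B) : del b (blockProd V B) = 0 := by
  induction B using Finset.induction_on with
  | empty => rw [blockProd_empty, del_one]
  | insert q B hq ih =>
    simp only [Finset.mem_insert, not_or] at hb
    rw [blockProd_insert V hq, del_mul_of_del_eq_zero _ _ _ (ih hb.2),
      (hV q).del_eq_zero (by rw [mem_legs]; exact hb.1), zero_mul]

end Legs

/-! ### The tree expansion of cluster correlations -/

section TreeExpansion

universe u

variable {Λ ι : Type*} [Fintype Λ] [DecidableEq Λ] [DecidableEq ι] {vtx : Λ → ι}

/-- `Grows vtx R T`: the lines in `T` form a tree with the vertex set `R`, to which a leaf was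
added by one line after the other. -/
inductive Grows (vtx : Λ → ι) : Finset ι → List (Λ × Λ) → Prop
  | single (q : ι) : Grows vtx {q} []
  | step {R : Finset ι} {T : List (Λ × Λ)} (a b : Λ) (h : Grows vtx R T) (ha : vtx a ∈ R)
      (hb : vtx b ∉ R) : Grows vtx (insert (vtx b) R) ((a, b) :: T)

/-- The connected correlation of the cluster `W` and the vertices in `S`; the coefficients `u` are
those of the reciprocal of the generating function. -/
def clusterCorrelation (V : ι → Subalgebra.center ℂ (Grassmann Λ)) (u : Finset ι → ℂ)
    (A : Λ → Λ → ℂ) (W : Grassmann Λ) (S : Finset ι) : ℂ :=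
  ∑ B ∈ S.powerset, expect (matForm A) (W * blockProd V B) * u (S \ B)

variable {V : ι → Subalgebra.center ℂ (Grassmann Λ)} {u : Finset ι → ℂ}

theorem del_del_mul_blockProd (hV : ∀ q, IsSignedMonomial (legs vtx q) (V q : Grassmann Λ))
    {S : Finset ι} {F : Finset Λ} {W : Grassmann Λ} (hW : IsSignedMonomial F W)
    (hF : ∀ a ∈ F, vtx a ∉ S) {B : Finset ι} (hB : B ⊆ S) {a b : Λ} (ha : vtx a ∉ S)
    (hb : vtx b ∈ S) :
    del b (del a (W * blockProd V B)) =
      if vtx b ∈ B then del b (del a (W * V (vtx b))) * blockProd V (B.erase (vtx b)) else 0 := by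
  split_ifs with h
  · rw [blockProd_eq_mul_erase V h, ← mul_assoc, del_mul_of_del_eq_zero a,
      del_mul_of_del_eq_zero b]
    · exact del_blockProd_eq_zero hV (Finset.notMem_erase _ _)
    · exact del_blockProd_eq_zero hV fun h' => ha (hB (Finset.mem_of_mem_erase h'))
  · rw [del_mul_of_del_eq_zero a _ _ (del_blockProd_eq_zero hV fun h' => ha (hB h')),
      del_mul_of_del_eq_zero b _ _ (del_blockProd_eq_zero hV h)]
    by_cases haF : a ∈ F
    · rw [(hW.del haF).del_eq_zero, zero_mul]
      exact fun h' => hF b (Finset.mem_of_mem_erase h') hb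
    · rw [hW.del_eq_zero haF, map_zero, zero_mul]

theorem sum_powerset_ite_erase (S : Finset ι) {j : ι} (hj : j ∈ S) (φ : Finset ι → ℂ) :
    ∑ B ∈ S.powerset, (if j ∈ B then φ (B.erase j) else 0) * u (S \ B) =
      ∑ B ∈ (S.erase j).powerset, φ B * u (S.erase j \ B) := by
  simp only [ite_mul, zero_mul]
  rw [← Finset.sum_filter]
  symm
  have hnot : ∀ B ∈ (S.erase j).powerset, j ∉ B := fun B hB h =>
    Finset.notMem_erase j S (Finset.mem_powerset.1 hB h)
  refine Finset.sum_bij (fun B _ => insert j B) ?_ ?_ ?_ ?_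
  · intro B hB
    refine Finset.mem_filter.2 ⟨Finset.mem_powerset.2 (Finset.insert_subset hj ?_),
      Finset.mem_insert_self _ _⟩
    exact (Finset.mem_powerset.1 hB).trans (Finset.erase_subset _ _)
  · intro B hB B' hB' h
    rw [← Finset.erase_insert (hnot B hB), h, Finset.erase_insert (hnot B' hB')]
  · intro B hB
    obtain ⟨hB, hjB⟩ := Finset.mem_filter.1 hB
    exact ⟨B.erase j, Finset.mem_powerset.2 (Finset.erase_subset_erase j (Finset.mem_powerset.1 hB)),
      Finset.insert_erase hjB⟩
  · intro B hB
    have : S \ insert j B = S.erase j \ B := by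
      ext q; simp only [Finset.mem_sdiff, Finset.mem_insert, Finset.mem_erase]; tauto
    rw [Finset.erase_insert (hnot B hB), this]

/-- One end of the new line must lie on a leg of `W` and the other on a vertex `j` that occurs in
the block. Removing `j` from the block turns the sum over `B ⊆ S` into the same sum over `S.erase j`
with the same `u`, so the form of the correlation is preserved. -/
theorem hasDerivAt_clusterCorrelation
    (hV : ∀ q, IsSignedMonomial (legs vtx q) (V q : Grassmann Λ))
    {S : Finset ι} {F : Finset Λ} {W : Grassmann Λ} (hW : IsSignedMonomial F W)
    (hF : ∀ a ∈ F, vtx a ∉ S) (A : Λ → Λ → ℂ) (s : ℝ) :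
    HasDerivAt (fun s => clusterCorrelation V u (rescale (vtx · ∈ S) s A) W S)
      (∑ a ∈ F, ∑ j ∈ S, ∑ b ∈ legs vtx j, twoPoint A a b *
        clusterCorrelation V u (rescale (vtx · ∈ S) s A) (del b (del a (W * V j)))
          (S.erase j)) s := by
  have h1 : HasDerivAt (fun s => clusterCorrelation V u (rescale (vtx · ∈ S) s A) W S)
      (∑ B ∈ S.powerset, expect (matForm (rescale (vtx · ∈ S) s A))
        (crossDel (vtx · ∈ S) A (W * blockProd V B)) * u (S \ B)) s :=
    HasDerivAt.fun_sum fun B _ => (hasDerivAt_expect_rescale _ A s _).mul_const _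
  refine h1.congr_deriv ?_
  have h2 : ∀ B ∈ S.powerset, crossDel (vtx · ∈ S) A (W * blockProd V B) =
      ∑ a ∈ F, ∑ j ∈ S, ∑ b ∈ legs vtx j, twoPoint A a b •
        (if j ∈ B then del b (del a (W * V j)) * blockProd V (B.erase j) else 0) := by
    intro B hB
    have hB := Finset.mem_powerset.1 hB
    rw [crossDel_apply]
    symm
    have hsub : F ⊆ Finset.univ.filter fun a => ¬vtx a ∈ S := fun a ha => by simp [hF a ha]
    have hfib : ∀ a ∈ Finset.univ.filter (fun a => ¬vtx a ∈ S),
        ∑ b with vtx b ∈ S, twoPoint A a b • del b (del a (W * blockProd V B)) =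
        ∑ j ∈ S, ∑ b ∈ legs vtx j, twoPoint A a b •
          (if j ∈ B then del b (del a (W * V j)) * blockProd V (B.erase j) else 0) := by
      intro a ha
      have ha : vtx a ∉ S := by simpa using ha
      rw [← Finset.sum_fiberwise_of_maps_to (g := vtx) (t := S) (fun b hb => by simpa using hb)]
      refine Finset.sum_congr rfl fun j hj => ?_
      refine Finset.sum_congr ?_ fun b hb => ?_
      · ext b; simp only [legs, Finset.mem_filter, Finset.mem_univ, true_and]
        constructor
        · exact fun h => h.2
        · rintro rfl; exact ⟨hj, rfl⟩
      · obtain rfl := (mem_legs vtx).1 hb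
        rw [del_del_mul_blockProd hV hW hF hB ha hj]
    rw [Finset.sum_congr rfl hfib]
    refine Finset.sum_subset hsub fun a ha haF => ?_
    rw [← hfib a ha]
    refine Finset.sum_eq_zero fun b _ => ?_
    have ha : vtx a ∉ S := by simpa using ha
    rw [del_mul_of_del_eq_zero a _ _ (del_blockProd_eq_zero hV fun h' => ha (hB h')),
      hW.del_eq_zero haF]
    simp
  rw [Finset.sum_congr rfl fun B hB => by rw [h2 B hB]]
  simp only [map_sum, map_smul, smul_eq_mul, Finset.sum_mul]
  rw [Finset.sum_comm]
  refine Finset.sum_congr rfl fun a _ => ?_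
  rw [Finset.sum_comm]
  refine Finset.sum_congr rfl fun j hj => ?_
  rw [Finset.sum_comm]
  refine Finset.sum_congr rfl fun b _ => ?_
  rw [clusterCorrelation, ← sum_powerset_ite_erase S hj, Finset.mul_sum]
  refine Finset.sum_congr rfl fun B _ => ?_
  split_ifs <;> simp [mul_assoc]

/-- The block has no legs outside `S`, so it does not see the covariance across the cut. Hence the
recursion for `u` survives every interpolation. -/
theorem expect_rescale_blockProd (hV : ∀ q, IsSignedMonomial (legs vtx q) (V q : Grassmann Λ))
    {S B : Finset ι} (hB : B ⊆ S) (A : Λ → Λ → ℂ) (s : ℝ) :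
    expect (matForm (rescale (vtx · ∈ S) s A)) (blockProd V B) =
      expect (matForm A) (blockProd V B) := by
  have h0 : crossDel (vtx · ∈ S) A (blockProd V B) = 0 := by
    rw [crossDel_apply]
    refine Finset.sum_eq_zero fun a ha => Finset.sum_eq_zero fun b _ => ?_
    have ha : vtx a ∉ S := by simpa using ha
    rw [del_blockProd_eq_zero hV fun h' => ha (hB h'), map_zero, smul_zero]
  have hd : ∀ s, HasDerivAt (fun s : ℝ => expect (matForm (rescale (vtx · ∈ S) s A))
      (blockProd V B)) 0 s := by
    intro s
    have := hasDerivAt_expect_rescale (vtx · ∈ S) A s (blockProd V B)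
    rwa [h0, map_zero] at this
  have := is_const_of_deriv_eq_zero (fun s => (hd s).differentiableAt) (fun s => (hd s).deriv) s 1
  simpa only [rescale_one] using this

/-- With the cut decoupled, `W` factors out and leaves a coefficient of `Z * (1 / Z) = 1` at the
nonempty set `S`, which is zero. -/
theorem clusterCorrelation_rescale_zero
    (hV : ∀ q, IsSignedMonomial (legs vtx q) (V q : Grassmann Λ))
    {S : Finset ι} {F : Finset Λ} {W : Grassmann Λ} (hW : IsSignedMonomial F W)
    (hF : ∀ a ∈ F, vtx a ∉ S) (A : Λ → Λ → ℂ)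
    (hu : ∑ B ∈ S.powerset, expect (matForm A) (blockProd V B) * u (S \ B) = 0) :
    clusterCorrelation V u (rescale (vtx · ∈ S) 0 A) W S = 0 := by
  have h : ∀ B ∈ S.powerset, expect (matForm (rescale (vtx · ∈ S) 0 A)) (W * blockProd V B) =
      expect (matForm (rescale (vtx · ∈ S) 0 A)) W * expect (matForm A) (blockProd V B) := by
    intro B hB
    have hB := Finset.mem_powerset.1 hB
    rw [← expect_rescale_blockProd hV hB A 0]
    obtain ⟨l, -, rfl, hl⟩ := hW
    have := expect_listMonomial_mul (rescale (vtx · ∈ S) 0 A) l (blockProd V B) (by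
      intro a ha b
      have ha : vtx a ∉ S := hF a (by simpa using ha)
      by_cases hb : vtx b ∈ S
      · left; simp [twoPoint_rescale, ha, hb]
      · right; exact del_blockProd_eq_zero hV fun h' => hb (hB h'))
    rcases hl with rfl | rfl
    · exact this
    · rw [neg_mul, map_neg, map_neg, this, neg_mul]
  rw [clusterCorrelation, Finset.sum_congr rfl fun B hB => by rw [h B hB, mul_assoc],
    ← Finset.mul_sum, hu, mul_zero]

theorem legPoly_merge (S : Finset ι) {F : Finset Λ} (hF : ∀ a ∈ F, vtx a ∉ S) (t : Λ → ℝ) (s : ℝ)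
    {a b : Λ} (ha : a ∈ F) {j : ι} (hj : j ∈ S) (hb : b ∈ legs vtx j) :
    legPoly (((F ∪ legs vtx j).erase a).erase b) (fun c => if vtx c = j then 1 else s * t c) =
      legPoly (F.erase a) (fun c => s * t c) * (1 + Polynomial.X) ^ ((legs vtx j).card - 1) := by
  have hFj : ∀ c ∈ F, vtx c ≠ j := fun c hc h => hF c hc (h ▸ hj)
  have hset : ((F ∪ legs vtx j).erase a).erase b = F.erase a ∪ (legs vtx j).erase b := by
    ext c
    simp only [Finset.mem_erase, Finset.mem_union]
    have hb' := (mem_legs vtx).1 hb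
    constructor
    · rintro ⟨h1, h2, h3 | h3⟩
      · exact Or.inl ⟨h2, h3⟩
      · exact Or.inr ⟨h1, h3⟩
    · rintro (⟨h1, h2⟩ | ⟨h1, h2⟩)
      · exact ⟨fun h => hFj c h2 (h ▸ hb'), h1, Or.inl h2⟩
      · exact ⟨h1, fun h => hFj a ha (h ▸ (mem_legs vtx).1 h2), Or.inr h2⟩
  have hdisj : Disjoint (F.erase a) ((legs vtx j).erase b) := by
    rw [Finset.disjoint_left]
    intro c h1 h2
    exact hFj c (Finset.mem_of_mem_erase h1) ((mem_legs vtx).1 (Finset.mem_of_mem_erase h2))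
  rw [legPoly, hset, Finset.prod_union hdisj]
  congr 1
  · refine Finset.prod_congr rfl fun c hc => ?_
    rw [if_neg (hFj c (Finset.mem_of_mem_erase hc))]
  · rw [← Finset.card_erase_of_mem hb, ← Finset.prod_const]
    refine Finset.prod_congr rfl fun c hc => ?_
    rw [if_pos ((mem_legs vtx).1 (Finset.mem_of_mem_erase hc)), map_one, one_mul]

/-- The bound by the sum over the trees that connect the cluster to the remaining vertices. -/
theorem prod_mul_norm_clusterCorrelation_le [Fintype ι] {κ : Λ → Prop} [DecidablePred κ]
    (hV : ∀ q, IsSignedMonomial (legs vtx q) (V q : Grassmann Λ)) (hu0 : u ∅ = 1)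
    {γ : ℝ} (hγ : 0 < γ) (w : Λ → Λ → ℝ) (hw : ∀ a b, 0 ≤ w a b) {K : ℝ} (hK : 0 ≤ K)
    (hwK : ∀ T, Grows vtx Finset.univ T → (T.map fun e => w e.1 e.2).prod ≤ K)
    (M : ℕ) {S : Finset ι} (hS : S.card = M) {F : Finset Λ} {W : Grassmann Λ}
    (hW : IsSignedMonomial F W) (hF : ∀ a ∈ F, vtx a ∉ S) {t : Λ → ℝ} (ht : ∀ a, 0 ≤ t a)
    {A : Λ → Λ → ℂ} (hA : IsGramCovariance.{u} κ γ A)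
    (hFS : ∀ a ∈ F, ∀ b, vtx b ∈ S → ‖twoPoint A a b‖ ≤ γ ^ 2 * (t a * w a b))
    (hSS : ∀ a b, vtx a ∈ S → vtx b ∈ S → vtx a ≠ vtx b → ‖twoPoint A a b‖ ≤ γ ^ 2 * w a b)
    (hu : ∀ C ⊆ S, C ≠ ∅ →
      ∑ B ∈ C.powerset, expect (matForm A) (blockProd V B) * u (C \ B) = 0)
    {T : List (Λ × Λ)} (hT : Grows vtx Sᶜ T) :
    (T.map fun e => w e.1 e.2).prod * ‖clusterCorrelation V u A W S‖ ≤
      K * γ ^ (F.card + ∑ q ∈ S, (legs vtx q).card) *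
        growthCount M (legPoly F t) (vertexPoly (fun q => (legs vtx q).card) S) := by
  induction M generalizing S F W t A T with
  | zero =>
    obtain rfl := Finset.card_eq_zero.1 hS
    rw [Finset.compl_empty] at hT
    have : clusterCorrelation V u A W ∅ = expect (matForm A) W := by
      simp [clusterCorrelation, blockProd_empty, hu0]
    rw [this, Finset.sum_empty, add_zero, growthCount, mul_one]
    exact mul_le_mul (hwK T hT) (hA.norm_expect_le hγ hW) (norm_nonneg _) hK
  | succ M ih =>
    have hSne : S ≠ ∅ := by rintro rfl; simp at hS
    set P := (T.map fun e => w e.1 e.2).prod with hP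
    have hP0 : 0 ≤ P := List.prod_nonneg fun x hx => by
      obtain ⟨e, -, rfl⟩ := List.mem_map.1 hx; exact hw _ _
    set n : ι → ℕ := fun q => (legs vtx q).card with hn
    set N := F.card + ∑ q ∈ S, n q with hN
    have hstep : ∀ s ∈ Set.Ico (0 : ℝ) 1, ∀ a ∈ F, ∀ j ∈ S, ∀ b ∈ legs vtx j,
        P * ‖twoPoint A a b * clusterCorrelation V u (rescale (vtx · ∈ S) s A)
          (del b (del a (W * V j))) (S.erase j)‖ ≤
        K * γ ^ N * (t a * growthCount M
          (legPoly (F.erase a) (fun a => s * t a) * (1 + Polynomial.X) ^ (n j - 1))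
          (vertexPoly n (S.erase j))) := by
      intro s hs a ha j hj b hb
      have hbj : vtx b = j := (mem_legs vtx).1 hb
      have hjS : vtx a ≠ j := fun h => hF a ha (h ▸ hj)
      have hdisj : Disjoint F (legs vtx j) := by
        rw [Finset.disjoint_left]
        intro c h1 h2
        exact hF c h1 (((mem_legs vtx).1 h2) ▸ hj)
      have haU : a ∈ F ∪ legs vtx j := Finset.mem_union_left _ ha
      have hbU : b ∈ (F ∪ legs vtx j).erase a :=
        Finset.mem_erase.2 ⟨fun h => hjS (h ▸ hbj), Finset.mem_union_right _ hb⟩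
      have hcompl : (S.erase j)ᶜ = insert (vtx b) Sᶜ := by
        rw [Finset.compl_erase, hbj]
      -- The weight `t c` collects the interpolation parameters between a cluster leg and the
      -- remaining vertices. Old legs gain the factor `s`; legs of `j` start at `1`, because the
      -- covariance inside `S` has not been rescaled.
      have key := ih (S := S.erase j) (by rw [Finset.card_erase_of_mem hj, hS]; rfl)
        (F := ((F ∪ legs vtx j).erase a).erase b) (((hW.mul (hV j) hdisj).del haU).del hbU)
        (t := fun c => if vtx c = j then 1 else s * t c) (A := rescale (vtx · ∈ S) s A)
        (T := (a, b) :: T)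
        (by
          intro c hc
          rcases Finset.mem_union.1 (Finset.mem_of_mem_erase (Finset.mem_of_mem_erase hc)) with h | h
          · exact fun h' => hF c h (Finset.mem_of_mem_erase h')
          · rw [(mem_legs vtx).1 h]; exact Finset.notMem_erase _ _)
        (by
          intro c
          split_ifs
          · exact zero_le_one
          · exact mul_nonneg hs.1 (ht c))
        (hA.rescale _ ⟨hs.1, hs.2.le⟩)
        (by
          intro c hc d hd
          have hdS := Finset.mem_of_mem_erase hd
          have hdj := Finset.ne_of_mem_erase hd
          rcases Finset.mem_union.1 (Finset.mem_of_mem_erase (Finset.mem_of_mem_erase hc)) with h | h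
          · have hcS := hF c h
            have hcj : vtx c ≠ j := fun h' => hcS (h' ▸ hj)
            simp only [twoPoint_rescale, hcS, hdS, iff_true, if_false, if_neg hcj, norm_mul,
              Complex.norm_real, Real.norm_eq_abs, abs_of_nonneg hs.1]
            calc s * ‖twoPoint A c d‖ ≤ s * (γ ^ 2 * (t c * w c d)) :=
                  mul_le_mul_of_nonneg_left (hFS c h d hdS) hs.1
              _ = γ ^ 2 * (s * t c * w c d) := by ring
          · have hcj : vtx c = j := (mem_legs vtx).1 h
            have hcS : vtx c ∈ S := hcj ▸ hj
            simp only [twoPoint_rescale, hdS, if_true, hcj, one_mul, iff_true]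
            simpa only [hcj, hj, if_true, iff_self] using
              hSS c d hcS hdS (by rw [hcj]; exact Ne.symm hdj))
        (by
          intro c d hc hd hcd
          have hcS := Finset.mem_of_mem_erase hc
          have hdS := Finset.mem_of_mem_erase hd
          simp only [twoPoint_rescale, hcS, hdS, if_true]
          exact hSS c d hcS hdS hcd)
        (by
          intro C hC hCne
          have hCS := hC.trans (Finset.erase_subset _ _)
          rw [← hu C hCS hCne]
          refine Finset.sum_congr rfl fun B hB => ?_
          rw [expect_rescale_blockProd hV ((Finset.mem_powerset.1 hB).trans hCS)])
        (by
          rw [hcompl]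
          exact Grows.step a b hT (Finset.mem_compl.2 (hF a ha))
            (fun h => Finset.mem_compl.1 h (hbj ▸ hj)))
      rw [legPoly_merge S hF t s ha hj hb] at key
      -- The `2` counts the two ends of the line, paid for by the `γ ^ 2` in the bound on the
      -- two-point function.
      have hcard : N = (((F ∪ legs vtx j).erase a).erase b).card + ∑ q ∈ S.erase j, n q + 2 := by
        have h1 := Finset.card_erase_add_one hbU
        have h2 := Finset.card_erase_add_one haU
        have h3 := Finset.card_union_of_disjoint hdisj
        have h4 := Finset.add_sum_erase S n hj
        have h5 : n j = (legs vtx j).card := rfl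
        omega
      rw [norm_mul]
      have hta := ht a
      have hb' : vtx b ∈ S := hbj ▸ hj
      calc P * (‖twoPoint A a b‖ * ‖clusterCorrelation V u (rescale (vtx · ∈ S) s A)
            (del b (del a (W * V j))) (S.erase j)‖)
          ≤ P * ((γ ^ 2 * (t a * w a b)) * ‖clusterCorrelation V u (rescale (vtx · ∈ S) s A)
            (del b (del a (W * V j))) (S.erase j)‖) := by
            gcongr
            exact hFS a ha b hb'
        _ = γ ^ 2 * t a * ((((a, b) :: T).map fun e => w e.1 e.2).prod *
            ‖clusterCorrelation V u (rescale (vtx · ∈ S) s A)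
            (del b (del a (W * V j))) (S.erase j)‖) := by
            rw [List.map_cons, List.prod_cons, ← hP]; ring
        _ ≤ γ ^ 2 * t a * _ := mul_le_mul_of_nonneg_left key (by positivity)
        _ = _ := by
            rw [hcard, pow_add]
            ring
    -- Correlation and majorant both vanish at `s = 0`, and the derivative of the first is dominated
    -- by that of the second. Comparison on the unit interval replaces the iterated integrals of the
    -- tree formula.
    have hfence := image_norm_le_of_norm_deriv_right_le_deriv_boundary (a := (0 : ℝ)) (b := 1)
      (f := fun s => (P : ℂ) * clusterCorrelation V u (rescale (vtx · ∈ S) s A) W S)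
      (B := fun s => K * γ ^ N * growthCount (M + 1) (legPoly F (fun a => s * t a))
        (vertexPoly n S))
      (fun s _ => ((hasDerivAt_clusterCorrelation hV hW hF A s).const_mul
        (P : ℂ)).continuousAt.continuousWithinAt)
      (fun s _ => ((hasDerivAt_clusterCorrelation hV hW hF A s).const_mul
        (P : ℂ)).hasDerivWithinAt)
      (by
        simp only [clusterCorrelation_rescale_zero hV hW hF A (hu S subset_rfl hSne), mul_zero,
          norm_zero, growthCount, zero_mul]
        simp [legPoly])
      (fun s => (hasDerivAt_growthCount F t n S M hS s).const_mul _)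
      (by
        intro s hs
        rw [norm_mul, Complex.norm_real, Real.norm_of_nonneg hP0]
        calc P * ‖∑ a ∈ F, ∑ j ∈ S, ∑ b ∈ legs vtx j, twoPoint A a b *
              clusterCorrelation V u (rescale (vtx · ∈ S) s A) (del b (del a (W * V j)))
                (S.erase j)‖
            ≤ P * ∑ a ∈ F, ∑ j ∈ S, ∑ b ∈ legs vtx j, ‖twoPoint A a b *
              clusterCorrelation V u (rescale (vtx · ∈ S) s A) (del b (del a (W * V j)))
                (S.erase j)‖ := by
              refine mul_le_mul_of_nonneg_left ?_ hP0
              refine (norm_sum_le _ _).trans (Finset.sum_le_sum fun a _ => ?_)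
              refine (norm_sum_le _ _).trans (Finset.sum_le_sum fun j _ => ?_)
              exact norm_sum_le _ _
          _ = ∑ a ∈ F, ∑ j ∈ S, ∑ b ∈ legs vtx j, P * ‖twoPoint A a b *
              clusterCorrelation V u (rescale (vtx · ∈ S) s A) (del b (del a (W * V j)))
                (S.erase j)‖ := by
              simp only [Finset.mul_sum]
          _ ≤ ∑ a ∈ F, ∑ j ∈ S, ∑ b ∈ legs vtx j, K * γ ^ N * (t a * growthCount M
              (legPoly (F.erase a) (fun a => s * t a) * (1 + Polynomial.X) ^ (n j - 1))
              (vertexPoly n (S.erase j))) :=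
              Finset.sum_le_sum fun a ha => Finset.sum_le_sum fun j hj =>
                Finset.sum_le_sum fun b hb => hstep s hs a ha j hj b hb
          _ = _ := by
              rw [Finset.sum_comm]
              simp only [Finset.sum_const, nsmul_eq_mul, Finset.mul_sum]
              refine Finset.sum_congr rfl fun j _ => Finset.sum_congr rfl fun a _ => ?_
              simp only [hn]
              ring)
      (Set.right_mem_Icc.2 zero_le_one)
    simpa only [rescale_one, one_mul, norm_mul, Complex.norm_real, Real.norm_of_nonneg hP0]
      using hfence

end TreeExpansion

/-! ### Grown line lists are spanning trees -/

section Trees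

theorem Grows.mem_edges {Λ ι : Type*} [DecidableEq ι] {vtx : Λ → ι} {R : Finset ι}
    {T : List (Λ × Λ)} (h : Grows vtx R T) :
    ∀ e ∈ T, vtx e.1 ∈ R ∧ vtx e.2 ∈ R ∧ vtx e.1 ≠ vtx e.2 := by
  induction h with
  | single q => simp
  | step a b h ha hb ih =>
    intro e he
    rcases List.mem_cons.1 he with rfl | he
    · exact ⟨Finset.mem_insert_of_mem ha, Finset.mem_insert_self _ _, fun h => hb (h ▸ ha)⟩
    · obtain ⟨h1, h2, h3⟩ := ih e he
      exact ⟨Finset.mem_insert_of_mem h1, Finset.mem_insert_of_mem h2, h3⟩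

theorem Grows.length_add_one {Λ ι : Type*} [DecidableEq ι] {vtx : Λ → ι} {R : Finset ι}
    {T : List (Λ × Λ)} (h : Grows vtx R T) : T.length + 1 = R.card := by
  induction h with
  | single q => simp
  | step a b h ha hb ih => rw [Finset.card_insert_of_notMem hb, ← ih, List.length_cons]

theorem Grows.nodup_edges {Λ ι : Type*} [DecidableEq ι] {vtx : Λ → ι} {R : Finset ι}
    {T : List (Λ × Λ)} (h : Grows vtx R T) :
    (T.map fun e => s(vtx e.1, vtx e.2)).Nodup := by
  induction h with
  | single q => simp
  | step a b h ha hb ih =>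
    rw [List.map_cons, List.nodup_cons]
    refine ⟨fun hmem => ?_, ih⟩
    obtain ⟨e, he, heq⟩ := List.mem_map.1 hmem
    obtain ⟨h1, h2, -⟩ := h.mem_edges e he
    have : vtx b ∈ s(vtx e.1, vtx e.2) := by rw [heq]; exact Sym2.mem_mk_right _ _
    rcases Sym2.mem_iff.1 this with h' | h'
    · exact hb (h' ▸ h1)
    · exact hb (h' ▸ h2)

theorem Grows.reachable {Λ ι : Type*} [DecidableEq ι] {vtx : Λ → ι} {R : Finset ι}
    {T : List (Λ × Λ)} (h : Grows vtx R T) (G : SimpleGraph ι)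
    (hG : ∀ e ∈ T, G.Adj (vtx e.1) (vtx e.2)) :
    ∀ x ∈ R, ∀ y ∈ R, G.Reachable x y := by
  induction h with
  | single q =>
    intro x hx y hy
    rw [Finset.mem_singleton.1 hx, Finset.mem_singleton.1 hy]
  | step a b h ha hb ih =>
    have ih := ih fun e he => hG e (List.mem_cons_of_mem _ he)
    have hadj : G.Reachable (vtx a) (vtx b) := (hG (a, b) List.mem_cons_self).reachable
    intro x hx y hy
    rcases Finset.mem_insert.1 hx with rfl | hx <;> rcases Finset.mem_insert.1 hy with rfl | hy
    · exact SimpleGraph.Reachable.refl _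
    · exact hadj.symm.trans (ih _ ha _ hy)
    · exact (ih _ hx _ ha).trans hadj
    · exact ih _ hx _ hy

/-- Each step attaches a new vertex, so the graph is connected with one edge fewer than vertices.
Its edges are pairwise distinct, so edges and lines correspond bijectively and products over either
agree. -/
theorem Grows.exists_isTree {Λ ι : Type*} [Fintype ι] [DecidableEq ι] {vtx : Λ → ι}
    {T : List (Λ × Λ)} (h : Grows vtx Finset.univ T) :
    ∃ G : SimpleGraph ι, G.IsTree ∧ ∃ line : G.edgeSet → Λ × Λ,
      (∀ e, line e ∈ T) ∧ (∀ e, s(vtx (line e).1, vtx (line e).2) = (e : Sym2 ι)) ∧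
      ∀ (_ : Fintype G.edgeSet) (w : Λ × Λ → ℝ), (T.map w).prod = ∏ e, w (line e) := by
  classical
  let edge : Λ × Λ → Sym2 ι := fun e => s(vtx e.1, vtx e.2)
  let G : SimpleGraph ι := SimpleGraph.fromEdgeSet {e | e ∈ T.map edge}
  have hGadj : ∀ e ∈ T, G.Adj (vtx e.1) (vtx e.2) := fun e he =>
    (SimpleGraph.fromEdgeSet_adj _).2 ⟨List.mem_map.2 ⟨e, he, rfl⟩, (h.mem_edges e he).2.2⟩
  have hedge : ∀ x, x ∈ G.edgeSet ↔ x ∈ T.map edge := by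
    intro x
    constructor
    · intro hx
      rw [SimpleGraph.edgeSet_fromEdgeSet] at hx
      exact hx.1
    · intro hx
      obtain ⟨e, he, rfl⟩ := List.mem_map.1 hx
      exact hGadj e he
  have hconn : G.Connected := by
    obtain ⟨q⟩ : Nonempty ι := by
      have := h.length_add_one
      rw [Finset.card_univ] at this
      exact Fintype.card_pos_iff.1 (by omega)
    have : Nonempty ι := ⟨q⟩
    exact SimpleGraph.Connected.mk fun x y =>
      h.reachable G hGadj x (Finset.mem_univ _) y (Finset.mem_univ _)
  have hcard : Nat.card G.edgeSet = T.length := by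
    have : G.edgeSet = ((T.map edge).toFinset : Set (Sym2 ι)) := by
      ext x; rw [hedge]; simp
    rw [this, Nat.card_coe_set_eq, Set.ncard_coe_finset, List.toFinset_card_of_nodup h.nodup_edges,
      List.length_map]
  have hex : ∀ x : G.edgeSet, ∃ e ∈ T, edge e = x := fun x => by
    obtain ⟨e, he, hx⟩ := List.mem_map.1 ((hedge x).1 x.2)
    exact ⟨e, he, hx⟩
  choose line hline hline' using hex
  refine ⟨G, ?_, line, hline, hline', ?_⟩
  · rw [SimpleGraph.isTree_iff_connected_and_card]
    refine ⟨hconn, ?_⟩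
    rw [hcard, h.length_add_one, Finset.card_univ, Nat.card_eq_fintype_card]
  · intro _ w
    have hnd : T.Nodup := h.nodup_edges.of_map _
    rw [← List.prod_toFinset w hnd]
    symm
    refine Finset.prod_bij (fun e _ => line e) ?_ ?_ ?_ ?_
    · intro e _; simpa using hline e
    · intro e _ e' _ hee
      apply Subtype.ext
      rw [← hline' e, ← hline' e', hee]
    · intro e he
      have he : e ∈ T := by simpa using he
      let x : G.edgeSet := ⟨edge e, (hedge _).2 (List.mem_map.2 ⟨e, he, rfl⟩)⟩
      exact ⟨x, Finset.mem_univ _,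
        List.inj_on_of_nodup_map h.nodup_edges (hline x) he (hline' x)⟩
    · intro e _; rfl

end Trees

/-! ### Line weights and the minimal tree length -/

section Lines

variable {𝕏 : Type*} [PseudoMetricSpace 𝕏] {p : ℕ} {m n : Fin p → ℕ}

/-- The legs of the vertices. -/
abbrev Leg (m n : Fin p → ℕ) : Type := (Σ q, Fin (m q)) ⊕ (Σ q, Fin (n q))

/-- The vertex of a leg. -/
def legVertex : Leg m n → Fin p := Sum.elim (fun x => x.1) (fun y => y.1)

/-- The weight of a line between two legs. -/
def lineWeight (X : (q : Fin p) → Fin (m q) → 𝕏) (Y : (q : Fin p) → Fin (n q) → 𝕏) (ω ℓ : ℝ) :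
    Leg m n → Leg m n → ℝ
  | Sum.inl x, Sum.inr y => ω * Real.exp (-dist (X x.1 x.2) (Y y.1 y.2) / ℓ)
  | Sum.inr y, Sum.inl x => ω * Real.exp (-dist (X x.1 x.2) (Y y.1 y.2) / ℓ)
  | _, _ => 0

theorem lineWeight_nonneg (X : (q : Fin p) → Fin (m q) → 𝕏) (Y : (q : Fin p) → Fin (n q) → 𝕏)
    {ω : ℝ} (hω : 0 ≤ ω) (ℓ : ℝ) (a b : Leg m n) : 0 ≤ lineWeight X Y ω ℓ a b := by
  rcases a with a | a <;> rcases b with b | b <;> simp only [lineWeight] <;> positivity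

theorem decayFactor_nonneg (L : ℝ≥0∞) (ℓ : ℝ) : 0 ≤ decayFactor L ℓ := by
  unfold decayFactor
  split_ifs
  · exact le_rfl
  · exact Real.exp_nonneg _

/-- A line of nonzero weight connects a `ψ`-leg to a `ψ̄`-leg. -/
theorem exists_orientation (X : (q : Fin p) → Fin (m q) → 𝕏) (Y : (q : Fin p) → Fin (n q) → 𝕏)
    (ω ℓ : ℝ) (a b : Leg m n) (h : lineWeight X Y ω ℓ a b ≠ 0) :
    ∃ c : (Σ q, Fin (m q)) × (Σ q, Fin (n q)), s(c.1.1, c.2.1) = s(legVertex a, legVertex b) ∧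
      lineWeight X Y ω ℓ a b =
        ω * Real.exp (-dist (X c.1.1 c.1.2) (Y c.2.1 c.2.2) / ℓ) := by
  rcases a with a | a <;> rcases b with b | b
  · exact absurd rfl h
  · exact ⟨(a, b), rfl, rfl⟩
  · exact ⟨(b, a), Sym2.eq_swap, rfl⟩
  · exact absurd rfl h

theorem prod_lineWeight_le (X : (q : Fin p) → Fin (m q) → 𝕏) (Y : (q : Fin p) → Fin (n q) → 𝕏)
    {ω ℓ : ℝ} (hω : 0 ≤ ω) (hℓ : 0 < ℓ) {T : List (Leg m n × Leg m n)}
    (hT : Grows legVertex Finset.univ T) :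
    (T.map fun e => lineWeight X Y ω ℓ e.1 e.2).prod ≤
      ω ^ (p - 1) * decayFactor (treeLength X Y) ℓ := by
  classical
  have hrhs : 0 ≤ ω ^ (p - 1) * decayFactor (treeLength X Y) ℓ :=
    mul_nonneg (pow_nonneg hω _) (decayFactor_nonneg _ _)
  -- Trees with a line between two legs of the same kind have weight zero. Excluding zero weights
  -- leaves only lines that give an admissible `LineChoice`, which also shows that the tree length
  -- is finite.
  by_cases hzero : ∃ e ∈ T, lineWeight X Y ω ℓ e.1 e.2 = 0
  · obtain ⟨e, he, h0⟩ := hzero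
    rw [List.prod_eq_zero (List.mem_map.2 ⟨e, he, h0⟩)]
    exact hrhs
  push Not at hzero
  obtain ⟨G, hG, line, hline, hedge, hprod⟩ := hT.exists_isTree
  choose c hc hw using fun e => exists_orientation X Y ω ℓ _ _ (hzero _ (hline e))
  let lc : LineChoice m n G := ⟨c, fun e => by rw [hc e, hedge e]⟩
  have hle : treeLength X Y ≤ ∑ e : G.edgeSet,
      edist (X (c e).1.1 (c e).1.2) (Y (c e).2.1 (c e).2.2) :=
    iInf_le_of_le G (iInf_le_of_le hG (iInf_le_of_le lc (le_of_eq rfl)))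
  have hsum : ∑ e : G.edgeSet, edist (X (c e).1.1 (c e).1.2) (Y (c e).2.1 (c e).2.2) =
      ENNReal.ofReal (∑ e : G.edgeSet, dist (X (c e).1.1 (c e).1.2) (Y (c e).2.1 (c e).2.2)) := by
    rw [ENNReal.ofReal_sum_of_nonneg fun _ _ => dist_nonneg]
    simp only [edist_dist]
  rw [hsum] at hle
  have hne : treeLength X Y ≠ ⊤ := (hle.trans_lt ENNReal.ofReal_lt_top).ne
  have hreal : (treeLength X Y).toReal ≤
      ∑ e : G.edgeSet, dist (X (c e).1.1 (c e).1.2) (Y (c e).2.1 (c e).2.2) :=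
    ENNReal.toReal_le_of_le_ofReal (Finset.sum_nonneg fun _ _ => dist_nonneg) hle
  have hcard : Fintype.card G.edgeSet = p - 1 := by
    have := (SimpleGraph.isTree_iff_connected_and_card.1 hG).2
    rw [Nat.card_eq_fintype_card, Nat.card_eq_fintype_card, Fintype.card_fin] at this
    omega
  rw [hprod inferInstance fun e => lineWeight X Y ω ℓ e.1 e.2]
  simp only [hw]
  rw [Finset.prod_mul_distrib, Finset.prod_const, Finset.card_univ, hcard, ← Real.exp_sum,
    decayFactor, if_neg hne]
  refine mul_le_mul_of_nonneg_left (Real.exp_le_exp.2 ?_) (pow_nonneg hω _)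
  rw [← Finset.sum_div, Finset.sum_neg_distrib]
  gcongr

end Lines

/-! ### Separate generators for the legs, and the resulting bound -/

section Assembly

universe v

theorem map_listMonomial {Λ Λ' : Type*} (pos : Λ → Λ') (l : List Λ) :
    ExteriorAlgebra.map (Finsupp.lmapDomain ℂ ℂ pos) (listMonomial l) =
      listMonomial (l.map pos) := by
  induction l with
  | nil => exact map_one _
  | cons a l ih =>
    rw [listMonomial_cons, map_mul, ih, List.map_cons, listMonomial_cons, gen,
      ExteriorAlgebra.map_apply_ι, Finsupp.lmapDomain_apply, Finsupp.mapDomain_single, gen]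

theorem matForm_compl {Λ Λ' : Type*} (A : Λ' → Λ' → ℂ) (pos : Λ → Λ') :
    (matForm A).compl₁₂ (Finsupp.lmapDomain ℂ ℂ pos) (Finsupp.lmapDomain ℂ ℂ pos) =
      matForm fun a b => A (pos a) (pos b) := by
  ext a b
  simp [matForm_single, Finsupp.mapDomain_single]

variable {𝕏 : Type*} {p : ℕ} {m n : Fin p → ℕ}

/-- The legs of a vertex, in the order of the factors of its monomial. -/
def legList (m n : Fin p → ℕ) (q : Fin p) : List (Leg m n) :=
  List.ofFn (fun j => Sum.inr ⟨q, j⟩) ++ List.ofFn (fun i => Sum.inl ⟨q, i⟩)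

theorem length_legList (q : Fin p) : (legList m n q).length = m q + n q := by
  simp [legList, add_comm]

theorem nodup_legList (q : Fin p) : (legList m n q).Nodup := by
  rw [legList, List.nodup_append']
  refine ⟨List.nodup_ofFn.2 fun i j h => by simpa using h,
    List.nodup_ofFn.2 fun i j h => by simpa using h, ?_⟩
  intro a h1 h2
  obtain ⟨i, rfl⟩ := List.mem_ofFn.1 h1
  obtain ⟨j, hj⟩ := List.mem_ofFn.1 h2
  cases hj

theorem toFinset_legList (q : Fin p) : (legList m n q).toFinset = legs legVertex q := by
  ext a
  rw [List.mem_toFinset, mem_legs, legList, List.mem_append, List.mem_ofFn, List.mem_ofFn]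
  rcases a with ⟨q', i⟩ | ⟨q', i⟩
  · constructor
    · rintro (⟨j, hj⟩ | ⟨j, hj⟩)
      · cases hj
      · cases hj; rfl
    · rintro rfl; exact Or.inr ⟨i, rfl⟩
  · constructor
    · rintro (⟨j, hj⟩ | ⟨j, hj⟩)
      · cases hj; rfl
      · cases hj
    · rintro rfl; exact Or.inl ⟨i, rfl⟩

theorem card_legs_legVertex (q : Fin p) :
    (legs (legVertex : Leg m n → Fin p) q).card = m q + n q := by
  rw [← toFinset_legList, List.toFinset_card_of_nodup (nodup_legList q), length_legList]

/-- The position of a leg. -/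
def legField (X : (q : Fin p) → Fin (m q) → 𝕏) (Y : (q : Fin p) → Fin (n q) → 𝕏) :
    Leg m n → 𝕏 ⊕ 𝕏 := Sum.map (fun x => X x.1 x.2) (fun y => Y y.1 y.2)

theorem listMonomial_map_legList (X : (q : Fin p) → Fin (m q) → 𝕏)
    (Y : (q : Fin p) → Fin (n q) → 𝕏) (q : Fin p) :
    listMonomial ((legList m n q).map (legField X Y)) = monomial (Y q) (X q) := by
  rw [legList, List.map_append, listMonomial_append, monomial, listMonomial, listMonomial,
    List.map_ofFn, List.map_ofFn, List.map_ofFn, List.map_ofFn]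
  rfl

/-- The monomial of a vertex, with a generator of its own for every leg. -/
def vertexMonomial (heven : ∀ q, Even (m q + n q)) (q : Fin p) :
    Subalgebra.center ℂ (Grassmann (Leg m n)) :=
  centralMonomial (legList m n q) (by rw [length_legList]; exact heven q)

theorem isSignedMonomial_vertexMonomial (heven : ∀ q, Even (m q + n q)) (q : Fin p) :
    IsSignedMonomial (legs legVertex q) (vertexMonomial heven q : Grassmann (Leg m n)) := by
  rw [← toFinset_legList]
  exact isSignedMonomial_listMonomial _ (nodup_legList q)

/-- The covariance of the legs. -/
def legCov (C : 𝕏 → 𝕏 → ℂ) (X : (q : Fin p) → Fin (m q) → 𝕏) (Y : (q : Fin p) → Fin (n q) → 𝕏)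
    (a b : Leg m n) : ℂ := fieldCov C (legField X Y a) (legField X Y b)

/-- Blocks are images of products of monomials in pairwise distinct leg generators, so coinciding
points, for which the field monomials may vanish, need no special treatment. -/
theorem gaussianExpectation_exp [Fintype 𝕏] (C : 𝕏 → 𝕏 → ℂ) (heven : ∀ q, Even (m q + n q))
    (hpos : ∀ q, 0 < m q + n q) (X : (q : Fin p) → Fin (m q) → 𝕏)
    (Y : (q : Fin p) → Fin (n q) → 𝕏) (x : Fin p → ℂ) :
    gaussianExpectation C (IsNilpotent.exp (∑ q, x q • monomial (Y q) (X q))) =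
      ∑ B : Finset (Fin p), (∏ q ∈ B, x q) *
        expect (matForm (legCov C X Y)) (blockProd (vertexMonomial heven) B) := by
  let V' : Fin p → Subalgebra.center ℂ (Grassmann (𝕏 ⊕ 𝕏)) := fun q =>
    centralMonomial ((legList m n q).map (legField X Y))
      (by rw [List.length_map, length_legList]; exact heven q)
  have hV' : ∀ q, (V' q : Grassmann (𝕏 ⊕ 𝕏)) = monomial (Y q) (X q) :=
    listMonomial_map_legList X Y
  have hsq : ∀ q, V' q * V' q = 0 := fun q => centralMonomial_mul_self _ _
    (by rw [List.length_map, length_legList]; exact hpos q)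
  have h := exp_sum_smul_eq V' hsq x
  simp only [hV'] at h
  rw [h, map_sum]
  refine Finset.sum_congr rfl fun B _ => ?_
  rw [map_smul, smul_eq_mul, gaussianExpectation_eq_expect,
    ← map_blockProd (ExteriorAlgebra.map (Finsupp.lmapDomain ℂ ℂ (legField X Y)))
      (vertexMonomial heven) V' (fun q => map_listMonomial _ _), expect_map, matForm_compl]
  rfl

theorem exists_connectedCorrelation_eq [Fintype 𝕏] {k : ℕ} {m n : Fin (k + 1) → ℕ}
    (C : 𝕏 → 𝕏 → ℂ) (heven : ∀ q, Even (m q + n q)) (hpos : ∀ q, 0 < m q + n q)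
    (X : (q : Fin (k + 1)) → Fin (m q) → 𝕏) (Y : (q : Fin (k + 1)) → Fin (n q) → 𝕏) :
    ∃ u : Finset (Fin (k + 1)) → ℂ, u ∅ = 1 ∧
      (∀ S, S ≠ ∅ → ∑ B ∈ S.powerset, expect (matForm (legCov C X Y))
        (blockProd (vertexMonomial heven) B) * u (S \ B) = 0) ∧
      connectedCorrelation C (fun q => monomial (Y q) (X q)) =
        clusterCorrelation (vertexMonomial heven) u (legCov C X Y)
          (vertexMonomial heven (Fin.last k) : Grassmann (Leg m n))
          (Finset.univ.erase (Fin.last k)) := by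
  obtain ⟨u, hu, h⟩ := exists_iteratedFDeriv_log_eq (fun B => expect (matForm (legCov C X Y))
    (blockProd (vertexMonomial heven) B)) (by rw [blockProd_empty, expect_one])
  refine ⟨u, ?_, fun S hS => by rw [hu S, if_neg hS], ?_⟩
  · simpa [blockProd_empty, expect_one] using hu ∅
  · rw [connectedCorrelation]
    simp only [gaussianExpectation_exp C heven hpos X Y]
    rw [h, clusterCorrelation]
    refine Finset.sum_congr rfl fun B hB => ?_
    rw [blockProd_insert _ fun h => Finset.notMem_erase _ _ (Finset.mem_powerset.1 hB h)]

theorem isGramCovariance_legCov {H : Type v} [NormedAddCommGroup H] [InnerProductSpace ℂ H]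
    (C : 𝕏 → 𝕏 → ℂ) (f g : 𝕏 → H) {γ : ℝ} (hC : ∀ X Y, C X Y = inner ℂ (f X) (g Y))
    (hf : ∀ X, ‖f X‖ ≤ γ) (hg : ∀ X, ‖g X‖ ≤ γ) (X : (q : Fin p) → Fin (m q) → 𝕏)
    (Y : (q : Fin p) → Fin (n q) → 𝕏) :
    IsGramCovariance.{v} (fun a : Leg m n => a.isLeft = true) γ (legCov C X Y) := by
  refine ⟨H, inferInstance, inferInstance, fun a => f (Sum.elim id id (legField X Y a)),
    fun a => g (Sum.elim id id (legField X Y a)), fun a => hf _, fun a => hg _, ?_⟩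
  intro a b
  rcases a with a | a <;> rcases b with b | b <;> simp [legCov, legField, fieldCov, hC]

theorem norm_twoPoint_legCov_le [PseudoMetricSpace 𝕏] (C : 𝕏 → 𝕏 → ℂ) {γ ω ℓ : ℝ}
    (hdecay : ∀ X X', max ‖C X X'‖ ‖C X' X‖ ≤ γ ^ 2 * ω * Real.exp (-dist X X' / ℓ))
    (X : (q : Fin p) → Fin (m q) → 𝕏) (Y : (q : Fin p) → Fin (n q) → 𝕏) (a b : Leg m n) :
    ‖twoPoint (legCov C X Y) a b‖ ≤ γ ^ 2 * lineWeight X Y ω ℓ a b := by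
  have h := fun X X' => (le_max_left _ _).trans (hdecay X X')
  rcases a with a | a <;> rcases b with b | b <;>
    simp only [twoPoint, legCov, legField, fieldCov, lineWeight, Sum.map_inl, Sum.map_inr,
      sub_zero, zero_sub, norm_neg, norm_zero, mul_zero, le_refl, ← mul_assoc]
  · exact h _ _
  · exact h _ _

/-- The bound on the connected correlation with the exact number of leg choices. -/
theorem norm_connectedCorrelation_le [Fintype 𝕏] [PseudoMetricSpace 𝕏]
    {H : Type v} [NormedAddCommGroup H] [InnerProductSpace ℂ H]
    (C : 𝕏 → 𝕏 → ℂ) (f g : 𝕏 → H) {γ ω ℓ : ℝ} (hγ : 0 < γ) (hω : 0 ≤ ω) (hℓ : 0 < ℓ)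
    (hC : ∀ X Y, C X Y = inner ℂ (f X) (g Y))
    (hf : ∀ X, ‖f X‖ ≤ γ) (hg : ∀ X, ‖g X‖ ≤ γ)
    (hdecay : ∀ X X', max ‖C X X'‖ ‖C X' X‖ ≤ γ ^ 2 * ω * Real.exp (-dist X X' / ℓ))
    {k : ℕ} {m n : Fin (k + 2) → ℕ} (hpos : ∀ q, 0 < m q + n q) (heven : ∀ q, Even (m q + n q))
    (X : (q : Fin (k + 2)) → Fin (m q) → 𝕏) (Y : (q : Fin (k + 2)) → Fin (n q) → 𝕏) :
    ‖connectedCorrelation C (fun q => monomial (Y q) (X q))‖ ≤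
      ω ^ (k + 1) * decayFactor (treeLength X Y) ℓ * γ ^ (∑ q, (m q + n q)) *
        (k.factorial * (vertexPoly (fun q => m q + n q) Finset.univ).coeff k) := by
  obtain ⟨u, hu0, hu, hconn⟩ := exists_connectedCorrelation_eq C heven hpos X Y
  have hW := isSignedMonomial_vertexMonomial (m := m) (n := n) heven
  have hK : 0 ≤ ω ^ (k + 1) * decayFactor (treeLength X Y) ℓ :=
    mul_nonneg (pow_nonneg hω _) (decayFactor_nonneg _ _)
  have hcompl : (Finset.univ.erase (Fin.last (k + 1)))ᶜ = {Fin.last (k + 1)} := by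
    ext q; simp
  have key := prod_mul_norm_clusterCorrelation_le (u := u) hW hu0 hγ (lineWeight X Y ω ℓ)
    (lineWeight_nonneg X Y hω ℓ) hK (fun T hT => prod_lineWeight_le X Y hω hℓ hT) (k + 1)
    (S := Finset.univ.erase (Fin.last (k + 1)))
    (by rw [Finset.card_erase_of_mem (Finset.mem_univ _), Finset.card_univ, Fintype.card_fin]; rfl)
    (hW (Fin.last (k + 1)))
    (fun a ha => by rw [(mem_legs _).1 ha]; exact Finset.notMem_erase _ _)
    (t := fun _ => 1) (fun _ => zero_le_one)
    (isGramCovariance_legCov C f g hC hf hg X Y)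
    (fun a _ b _ => by rw [one_mul]; exact norm_twoPoint_legCov_le C hdecay X Y a b)
    (fun a b _ _ _ => norm_twoPoint_legCov_le C hdecay X Y a b)
    (fun S _ hS => hu S hS)
    (T := []) (by rw [hcompl]; exact Grows.single _)
  rw [← hconn, List.map_nil, List.prod_nil, one_mul] at key
  refine key.trans (le_of_eq ?_)
  have e1 : (legs (legVertex : Leg m n → Fin (k + 2)) (Fin.last (k + 1))).card +
      ∑ q ∈ Finset.univ.erase (Fin.last (k + 1)),
        (legs (legVertex : Leg m n → Fin (k + 2)) q).card = ∑ q, (m q + n q) := by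
    rw [Finset.add_sum_erase _ (fun q => (legs (legVertex : Leg m n → Fin (k + 2)) q).card)
      (Finset.mem_univ _)]
    exact Finset.sum_congr rfl fun q _ => card_legs_legVertex q
  -- For the root `E = (1 + X) ^ n` with all weights `1`, so its derivative is precisely the missing
  -- vertex factor: the count does not depend on the root.
  have e2 : Polynomial.derivative
        (legPoly (legs (legVertex : Leg m n → Fin (k + 2)) (Fin.last (k + 1))) fun _ => 1) *
      vertexPoly (fun q => (legs (legVertex : Leg m n → Fin (k + 2)) q).card)
        (Finset.univ.erase (Fin.last (k + 1))) =
      vertexPoly (fun q => m q + n q) Finset.univ := by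
    simp only [card_legs_legVertex]
    rw [vertexPoly, vertexPoly, ← Finset.mul_prod_erase Finset.univ _
      (Finset.mem_univ (Fin.last (k + 1)))]
    congr 1
    rw [legPoly, Finset.prod_const, card_legs_legVertex, map_one, one_mul, Polynomial.derivative_pow]
    simp
  rw [e1, growthCount, e2]

end Assembly

end FermionicCumulant

end

theorem theorem4 {𝕏 : Type*} [Fintype 𝕏] [PseudoMetricSpace 𝕏]
    {H : Type*} [NormedAddCommGroup H] [InnerProductSpace ℂ H] [CompleteSpace H]
    (C : 𝕏 → 𝕏 → ℂ) (f g : 𝕏 → H) (γ ω ℓ : ℝ) (hγ : 0 < γ) (hℓ : 0 < ℓ)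
    (hC : ∀ X Y, C X Y = inner ℂ (f X) (g Y))
    (hf : ∀ X, ‖f X‖ ≤ γ) (hg : ∀ X, ‖g X‖ ≤ γ)
    (hdecay : ∀ X X', max ‖C X X'‖ ‖C X' X‖ ≤ γ ^ 2 * ω * Real.exp (-dist X X' / ℓ))
    (p : ℕ) (hp : 2 ≤ p) (m mBar : Fin p → ℕ)
    (hpos : ∀ q, 0 < m q + mBar q) (heven : ∀ q, Even (m q + mBar q))
    (X : (q : Fin p) → Fin (m q) → 𝕏) (Y : (q : Fin p) → Fin (mBar q) → 𝕏) :
    ‖FermionicCumulant.connectedCorrelation C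
        (fun q => FermionicCumulant.monomial (Y q) (X q))‖ ≤
      (Nat.factorial (p - 2) : ℝ) * ω ^ (p - 1) * (3 * γ) ^ (∑ q, mBar q + ∑ q, m q) *
        FermionicCumulant.decayFactor (FermionicCumulant.treeLength X Y) ℓ ∧
    ‖FermionicCumulant.connectedCorrelation C
        (fun q => FermionicCumulant.monomial (Y q) (X q))‖ ≤
      (Nat.factorial (p - 2) : ℝ) * (2 * ω) ^ (p - 1) *
        (2 * γ) ^ (∑ q, mBar q + ∑ q, m q) *
        FermionicCumulant.decayFactor (FermionicCumulant.treeLength X Y) ℓ := by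
  obtain ⟨k, rfl⟩ := Nat.exists_eq_add_of_le' hp
  -- Every vertex has a leg, so there is a point at which the decay bound can be evaluated.
  have hω : 0 ≤ ω := by
    have x₀ : 𝕏 := by
      have h := hpos 0
      by_cases h0 : 0 < m 0
      · exact X 0 ⟨0, h0⟩
      · exact Y 0 ⟨0, by omega⟩
    have h := (norm_nonneg _).trans ((le_max_left _ _).trans (hdecay x₀ x₀))
    have h1 : 0 ≤ γ ^ 2 * ω := nonneg_of_mul_nonneg_left h (Real.exp_pos _)
    exact nonneg_of_mul_nonneg_right h1 (by positivity)
  have key := FermionicCumulant.norm_connectedCorrelation_le C f g hγ hω hℓ hC hf hg hdecay hpos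
    heven X Y
  have hD := FermionicCumulant.decayFactor_nonneg (FermionicCumulant.treeLength X Y) ℓ
  have hN : ∑ q, (m q + mBar q) = ∑ q, mBar q + ∑ q, m q := by
    rw [Finset.sum_add_distrib, add_comm]
  have h3 := FermionicCumulant.coeff_vertexPoly_le_three_pow (fun q => m q + mBar q) Finset.univ k
  have h2 := FermionicCumulant.coeff_vertexPoly_le_two_pow (fun q => m q + mBar q) Finset.univ k
  rw [hN] at key h3 h2
  have e1 : k + 2 - 2 = k := rfl
  have e2 : k + 2 - 1 = k + 1 := rfl
  rw [e1, e2]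
  set D := FermionicCumulant.decayFactor (FermionicCumulant.treeLength X Y) ℓ
  set N := ∑ q, mBar q + ∑ q, m q
  constructor
  · refine key.trans ?_
    calc ω ^ (k + 1) * D * γ ^ N * (k.factorial * _)
        ≤ ω ^ (k + 1) * D * γ ^ N * (k.factorial * 3 ^ N) := by gcongr
      _ = k.factorial * ω ^ (k + 1) * (3 * γ) ^ N * D := by rw [mul_pow]; ring
  · refine key.trans ?_
    calc ω ^ (k + 1) * D * γ ^ N * (k.factorial * _)
        ≤ ω ^ (k + 1) * D * γ ^ N * (k.factorial * (2 ^ k * 2 ^ N)) := by gcongr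
      -- The coefficient bound only needs `2 ^ (p - 2)`; one more factor `2` is given away so that
      -- every `ω` carries one.
      _ ≤ ω ^ (k + 1) * D * γ ^ N * (k.factorial * (2 ^ (k + 1) * 2 ^ N)) := by
          gcongr
          · norm_num
          · omega
      _ = k.factorial * (2 * ω) ^ (k + 1) * (2 * γ) ^ N * D := by rw [mul_pow, mul_pow]; ring
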